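/- Let $n\ge 1$ and let $Z\subset\mathbb{R}^n$ be open, with coordinates $z=(z^1,\dots,z^n)=(x^1,\dots,x^{n-1},u)$, where the $x^a=z^a$ ($a<n$) are independent variables and $u=z^n$ is the dependent variable. Fix $2\le r\le\infty$; solutions are functions $u(x)$ of class $C^r$ on open sets, with graph in $Z$. Consider a second-order scalar equation $E(x,u;u_a;u_{ab})=0$ over $Z$. Its covariant form is the equation $\tilde E[w](z)=0$ together with $w=0$ for a function $w(z)$, where $\tilde E[w]$ arises from $E$ by the implicit-differentiation rules $$u_a=-\frac{w_a}{w_n},\qquad u_{ab}=-\frac{w_{ab}}{w_n}+\frac{w_{na}w_b}{w_n^2}+\frac{w_{nb}w_a}{w_n^2}-\frac{w_aw_bw_{nn}}{w_n^3}.$$ Let $G$ be an $n$-dimensional Lie group acting smoothly (possibly only locally) on $Z$. The action is simply transitive: for all $z,z'\in Z$ exactly one $g\in G$ has $gz=z'$, and the infinitesimal generators have rank $n$ at each point. Assume that $G$ is a group of point symmetries of the equation: whenever $g\in G$ is defined on the graph of a solution and maps it onto the graph of a $C^r$ function on an open set, with graph in $Z$, that function is a solution. Fix $z_0\in Z$ and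 a basis $e_1,\dots,e_n$ of $T_{z_0}Z$. Identify $Z$ with the local Lie group with identity $z_0$ on which $G$ acts by right translations, and let $\eta_i$ be the right-invariant vector field with $\eta_i(z_0)=e_i$, that is, $\eta_i(z)=(R_z)_*e_i$, where $R_z$ is the transformation in $G$ that carries $z_0$ to $z$. Put $$w_{(i)}=\eta_i w,\qquad w_{(ij)}=\tfrac12(\eta_i\eta_j+\eta_j\eta_i)w,$$ $$I_{(i)}=\frac{w_{(i)}}{w_{(n)}}\ (i<n),\qquad I_{(ij)}=\frac{w_{(i)}^2w_{(jj)}-2w_{(i)}w_{(j)}w_{(ij)}+w_{(j)}^2w_{(ii)}}{w_{(n)}^3}\ (1\le i<j\le n).$$ Call $w$ generic at $z$ if $w_n\neq0$, $w_{(n)}\ne 0$, and $w_{(a)}w_{(b)}\neq 0$ for all $a<b<n$ at $z$. Then there is a real function $F$ of the variables $(I_{(i)},I_{(ij)})$ such that the covariant form of the equation is $$F(I_{(i)},I_{(ij)})=0,\qquad w=0,$$ in the following sense. (1) If $V\subset Z$ is open and $w$ is a $C^r$ function on $V$ that is generic at every point of $V$ with $w=0$, then the following are equivalent: the surface $w=0$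 in $V$ is a solution (every $C^r$ function on an open set whose graph lies in it is a solution); $\tilde E[w]=0$ at all points of $V$ with $w=0$; $F(I_{(i)},I_{(ij)})=0$ at all points of $V$ with $w=0$. (2) If the equation is locally solvable (every $2$-jet over $Z$ that satisfies $E=0$ is the $2$-jet of a local solution), then $\tilde E[w](z)=0$ if and only if $F(I_{(i)},I_{(ij)})=0$ at $z$, for every $z\in Z$ and every function $w$ that is $C^r$ near $z$, vanishes at $z$ and is generic at $z$. If $E$ is continuous, $F$ can be chosen of class $C^\infty$ on the whole space of the variables $(I_{(i)},I_{(ij)})$. -/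

import Mathlib

open scoped Manifold ContDiff

noncomputable section

namespace CovariantPDE

/-- The space of the `m` independent variables `x¹, …, xᵐ` and the dependent variable `u`.
With `n = m + 1` these are the coordinates `z¹, …, zⁿ`, and `zⁿ = u` has the index `Fin.last m`. -/
abbrev Pt (m : ℕ) : Type := Fin (m + 1) → ℝ

/-- The point `z = (x, u)`. -/
def pt {m : ℕ} (x : Fin m → ℝ) (u : ℝ) : Pt m := Fin.snoc (α := fun _ => ℝ) x u

/-! ### Second-order scalar equations and their solutions -/

/-- The left-hand side `E(x, u; u_a; u_ab)` of a second-order scalar equation `E = 0`,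
as a function of `z = (x, u)`, of the `u_a` and of the (symmetric) matrix of the `u_ab`. -/
abbrev PDE2 (m : ℕ) : Type := Pt m → (Fin m → ℝ) → Matrix (Fin m) (Fin m) ℝ → ℝ

/-- The partial derivative `∂f/∂yᵃ` at `y`. -/
def pd {k : ℕ} (a : Fin k) (f : (Fin k → ℝ) → ℝ) (y : Fin k → ℝ) : ℝ :=
  fderiv ℝ f y (Pi.single a 1)

/-- The first derivatives `u_a`. -/
def grad {m : ℕ} (u : (Fin m → ℝ) → ℝ) (x : Fin m → ℝ) : Fin m → ℝ := fun a => pd a u x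

/-- The second derivatives `u_ab`. -/
def hess {m : ℕ} (u : (Fin m → ℝ) → ℝ) (x : Fin m → ℝ) : Matrix (Fin m) (Fin m) ℝ :=
  Matrix.of fun a b => pd a (pd b u) x

/-- The surface `u = f(x)`, `x ∈ Ω`. -/
def graph {m : ℕ} (Ω : Set (Fin m → ℝ)) (u : (Fin m → ℝ) → ℝ) : Set (Pt m) :=
  (fun x => pt x (u x)) '' Ω

/-- `u` is a `C^r` function on the open set `Ω` whose graph lies in `Z`. -/
structure IsFunctionIn {m : ℕ} (r : ℕ∞) (Z : Set (Pt m)) (Ω : Set (Fin m → ℝ))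
    (u : (Fin m → ℝ) → ℝ) : Prop where
  isOpen : IsOpen Ω
  contDiffOn : ContDiffOn ℝ r u Ω
  graph_subset : graph Ω u ⊆ Z

/-- `u` is a (local) solution of class `C^r` of the equation `E = 0` on the open set `Ω`. -/
structure IsSolution {m : ℕ} (r : ℕ∞) (Z : Set (Pt m)) (E : PDE2 m) (Ω : Set (Fin m → ℝ))
    (u : (Fin m → ℝ) → ℝ) : Prop extends IsFunctionIn r Z Ω u where
  eq_zero : ∀ x ∈ Ω, E (pt x (u x)) (grad u x) (hess u x) = 0

/-- Every 2-jet over `Z` that satisfies `E = 0` is the 2-jet of a local solution. -/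
def LocallySolvable {m : ℕ} (r : ℕ∞) (Z : Set (Pt m)) (E : PDE2 m) : Prop :=
  ∀ z ∈ Z, ∀ (p : Fin m → ℝ) (q : Matrix (Fin m) (Fin m) ℝ), q.IsSymm → E z p q = 0 →
    ∃ Ω u, IsSolution r Z E Ω u ∧ ∃ x ∈ Ω, pt x (u x) = z ∧ grad u x = p ∧ hess u x = q

/-! ### Simply transitive local Lie groups of transformations -/

/-- A smooth, possibly only local, action of an `(m + 1)`-dimensional Lie group `G` on the set `Z`:
`act g z` is meaningful for `(g, z) ∈ dom`. A global action is the case `dom = G × Z`; the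
restriction of a global action on a larger manifold to a coordinate domain `Z` has
`dom = {(g, z) | z ∈ Z, g z ∈ Z}`. -/
structure LocalAction {m : ℕ} (G : Type*) [Group G] [TopologicalSpace G]
    [ChartedSpace (EuclideanSpace ℝ (Fin (m + 1))) G] (Z : Set (Pt m)) where
  /-- the pairs `(g, z)` for which `g z` is defined -/
  dom : Set (G × Pt m)
  /-- the transformation `z ↦ g z` -/
  act : G → Pt m → Pt m
  isOpen_dom : IsOpen dom
  mem_of_dom : ∀ {g z}, (g, z) ∈ dom → z ∈ Z
  act_mem : ∀ {g z}, (g, z) ∈ dom → act g z ∈ Z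
  one_mem : ∀ {z}, z ∈ Z → (1, z) ∈ dom
  one_act : ∀ {z}, z ∈ Z → act 1 z = z
  inv_mem : ∀ {g z}, (g, z) ∈ dom → (g⁻¹, act g z) ∈ dom
  mul_mem : ∀ {g h z}, (g, z) ∈ dom → (h, act g z) ∈ dom → (h * g, z) ∈ dom
  mul_act : ∀ {g h z}, (g, z) ∈ dom → (h, act g z) ∈ dom → act (h * g) z = act h (act g z)
  smooth : ContMDiffOn ((𝓡 (m + 1)).prod 𝓘(ℝ, Pt m)) 𝓘(ℝ, Pt m) ∞
    (fun p : G × Pt m => act p.1 p.2) dom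

section Action

variable {m : ℕ} {G : Type*} [Group G] [TopologicalSpace G]
  [ChartedSpace (EuclideanSpace ℝ (Fin (m + 1))) G] {Z : Set (Pt m)}

/-- The value at `z` of the infinitesimal generator of the action belonging to the element `v` of
the Lie algebra `T_1 G`. -/
def LocalAction.generator (A : LocalAction G Z) (v : TangentSpace (𝓡 (m + 1)) (1 : G))
    (z : Pt m) : Pt m :=
  mfderiv (𝓡 (m + 1)) 𝓘(ℝ, Pt m) (fun g : G => A.act g z) 1 v

/-- The action is simply transitive: it is transitive with trivial stabilizers, and at every point
the generators span the tangent space without linear relations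
(rank of the generators = dimension of the Lie algebra = dimension of `Z`). -/
structure LocalAction.IsSimplyTransitive (A : LocalAction G Z) : Prop where
  existsUnique : ∀ z ∈ Z, ∀ z' ∈ Z, ∃! g : G, (g, z) ∈ A.dom ∧ A.act g z = z'
  rank : ∀ z ∈ Z, Function.Bijective
    (fun v : TangentSpace (𝓡 (m + 1)) (1 : G) => A.generator v z)

/-- `G` is a group of point symmetries of `E = 0`: whenever `g` is defined on the graph of a
solution and maps it onto the graph of a function, this function is a solution. -/
def LocalAction.IsSymmetryGroup (A : LocalAction G Z) (r : ℕ∞) (E : PDE2 m) : Prop :=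
  ∀ (g : G) (Ω Ω' : Set (Fin m → ℝ)) (u u' : (Fin m → ℝ) → ℝ),
    IsSolution r Z E Ω u → (∀ z ∈ graph Ω u, (g, z) ∈ A.dom) →
    IsFunctionIn r Z Ω' u' → A.act g '' graph Ω u = graph Ω' u' →
    IsSolution r Z E Ω' u'

/-- The element of `G` that carries `z₀` to `z`. -/
def LocalAction.elt (A : LocalAction G Z) (z₀ z : Pt m) : G :=
  Classical.epsilon fun g : G => (g, z₀) ∈ A.dom ∧ A.act g z₀ = z

/-- The right-invariant vector field with the value `e` at `z₀`. A simply transitive action turns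
`Z` into a local Lie group with identity `z₀` and product `z * z' = act (elt z₀ z') z`, so that `G`
acts by the right translations `R_{z'} = act (elt z₀ z')` and its generators are the left-invariant
fields; the field defined here is `z ↦ (R_z)_* e`. -/
def LocalAction.rightInvariant (A : LocalAction G Z) (z₀ e : Pt m) (z : Pt m) : Pt m :=
  fderiv ℝ (A.act (A.elt z₀ z)) z₀ e

end Action

/-! ### Covariant form -/

/-- The derivative `X f` of a function along a vector field. -/
def along {m : ℕ} (X : Pt m → Pt m) (f : Pt m → ℝ) (z : Pt m) : ℝ := fderiv ℝ f z (X z)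

/-- `w_(i) = η_i w`. -/
def w1 {m : ℕ} (η : Fin (m + 1) → Pt m → Pt m) (w : Pt m → ℝ) (i : Fin (m + 1)) (z : Pt m) : ℝ :=
  along (η i) w z

/-- `w_(ij) = (η_i η_j w + η_j η_i w) / 2`. -/
def w2 {m : ℕ} (η : Fin (m + 1) → Pt m → Pt m) (w : Pt m → ℝ) (i j : Fin (m + 1)) (z : Pt m) : ℝ :=
  (along (η i) (along (η j) w) z + along (η j) (along (η i) w) z) / 2

/-- The pairs `i < j` of indices in `1, …, n`. -/
abbrev Pairs (m : ℕ) : Type := {p : Fin (m + 1) × Fin (m + 1) // p.1 < p.2}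

/-- `I_(a) = w_(a) / w_(n)`, `a = 1, …, n - 1`. -/
def I1 {m : ℕ} (η : Fin (m + 1) → Pt m → Pt m) (w : Pt m → ℝ) (z : Pt m) : Fin m → ℝ :=
  fun a => w1 η w a.castSucc z / w1 η w (Fin.last m) z

/-- `I_(ij) = (w_(i)² w_(jj) - 2 w_(i) w_(j) w_(ij) + w_(j)² w_(ii)) / w_(n)³`, `i < j`. -/
def I2 {m : ℕ} (η : Fin (m + 1) → Pt m → Pt m) (w : Pt m → ℝ) (z : Pt m) : Pairs m → ℝ :=
  fun p =>
    let i := p.1.1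
    let j := p.1.2
    (w1 η w i z ^ 2 * w2 η w j j z - 2 * w1 η w i z * w1 η w j z * w2 η w i j z
      + w1 η w j z ^ 2 * w2 η w i i z) / w1 η w (Fin.last m) z ^ 3

/-- The derivatives `u_a = -w_a / w_n` of the function `u(x)` defined by `w = 0`. -/
def implicitGrad {m : ℕ} (w : Pt m → ℝ) (z : Pt m) : Fin m → ℝ :=
  fun a => -pd a.castSucc w z / pd (Fin.last m) w z

/-- The second derivatives
`u_ab = -w_ab/w_n + w_na w_b/w_n² + w_nb w_a/w_n² - w_a w_b w_nn/w_n³`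
of the function `u(x)` defined by `w = 0`. -/
def implicitHess {m : ℕ} (w : Pt m → ℝ) (z : Pt m) : Matrix (Fin m) (Fin m) ℝ :=
  Matrix.of fun a b =>
    let n := Fin.last m
    let a' := a.castSucc
    let b' := b.castSucc;
    -(pd a' (pd b' w) z / pd n w z)
      + pd n (pd a' w) z * pd b' w z / pd n w z ^ 2
      + pd n (pd b' w) z * pd a' w z / pd n w z ^ 2
      - pd a' w z * pd b' w z * pd n (pd n w) z / pd n w z ^ 3

/-- The left-hand side of the covariant form of `E = 0`. -/
def covariant {m : ℕ} (E : PDE2 m) (w : Pt m → ℝ) (z : Pt m) : ℝ :=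
  E z (implicitGrad w z) (implicitHess w z)

/-- The general-position condition on `w` at `z`: `w = 0` can be solved for `u` (`w_n ≠ 0`), the
quotients by `w_(n)` are defined, and no product `w_(a) w_(b)` with `a < b < n` vanishes (for
`n ≤ 2` there is no such product). -/
structure IsGeneric {m : ℕ} (η : Fin (m + 1) → Pt m → Pt m) (w : Pt m → ℝ) (z : Pt m) : Prop where
  pd_last_ne : pd (Fin.last m) w z ≠ 0
  last_ne : w1 η w (Fin.last m) z ≠ 0
  mul_ne : ∀ a b : Fin m, a < b → w1 η w a.castSucc z * w1 η w b.castSucc z ≠ 0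

/-- The surface `w = 0` in `V` is a solution of `E = 0`: every function `u(x)` with
`w(x, u(x)) = 0` is a solution. -/
def SurfaceIsSolution {m : ℕ} (r : ℕ∞) (Z : Set (Pt m)) (E : PDE2 m) (V : Set (Pt m))
    (w : Pt m → ℝ) : Prop :=
  ∀ Ω u, IsFunctionIn r Z Ω u → graph Ω u ⊆ {z ∈ V | w z = 0} → IsSolution r Z E Ω u

end CovariantPDE

end

/-! For w with w_n ≠ 0, the covariant equation sees w at z only through the 2-jet of its level
surface: Dw up to a factor l ≠ 0, and D²w on ker Dw up to the same factor. This is the relation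
`Contact`; it amounts to equality of the implicit derivatives u_a, u_ab (`contact_of_implicit_eq`,
`Contact.implicit_eq`).

The invariants encode the same data in the frame η. With τ = w_(i) η_j - w_(j) η_i, which is tangent
to the level surface, the numerator of I_(ij) is D²w(τ, τ) plus an expression of degree 3 in Dw
whose coefficients come from the derivatives of the frame (`jetI2_num_eq`). So contact implies equal
invariants, and at a fixed point the invariants of a generic jet determine its contact class
(`contact_of_jetI_eq`).

The action preserves the frame, hence the invariants (`I_comp_act`), and it is transitive. A generic
jet is therefore determined by its invariants up to contact and G. If a solution realises the values
κ at one point, moving it by G makes every generic jet with values κ, at any point of Z, satisfy the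
equation (`covariant_eq_zero_of_solution`).

Take for F any function whose zero set is the complement of `violating`, the set of values attained
by generic jets with E ≠ 0. Then F = 0 gives the equation at once. The converse needs an actual
solution with the given jet, because the symmetry hypothesis concerns solutions and not jets: it is
the implicit function if the equation holds along the whole surface, or it comes from local
solvability. If E is continuous, `violating` is open (`isOpen_violating`), hence the support of a
smooth function. -/

noncomputable section

namespace CovariantPDE

open Filter Topology

/-! ### Algebra of 2-jets: contact and invariants. -/

section

variable {m : ℕ}

/-- First-order part of the 2-jet of the function `u` with `w(x, u(x)) = 0`, for `p = Dw`. -/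
def jetGrad (p : Pt m →L[ℝ] ℝ) : Fin m → ℝ :=
  fun a => -p (Pi.single a.castSucc 1) / p (Pi.single (Fin.last m) 1)

/-- Second-order part of the 2-jet of the function `u` with `w(x, u(x)) = 0`, for `p = Dw` and
`q = D²w`. -/
def jetHess (p : Pt m →L[ℝ] ℝ) (q : Pt m →L[ℝ] Pt m →L[ℝ] ℝ) : Matrix (Fin m) (Fin m) ℝ :=
  Matrix.of fun a b =>
    let n : Pt m := Pi.single (Fin.last m) 1
    let a' : Pt m := Pi.single a.castSucc 1
    let b' : Pt m := Pi.single b.castSucc 1;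
    -(q a' b' / p n) + q n a' * p b' / p n ^ 2 + q n b' * p a' / p n ^ 2
      - p a' * p b' * q n n / p n ^ 3

/-- `w_(ij)` in terms of `p = Dw`, `q = D²w`, the values `b i` of the vector fields `η_i`
and the derivatives `c i j` of `η_j` along `η_i`. -/
def jetW2 (b : Fin (m + 1) → Pt m) (c : Fin (m + 1) → Fin (m + 1) → Pt m)
    (p : Pt m →L[ℝ] ℝ) (q : Pt m →L[ℝ] Pt m →L[ℝ] ℝ) (i j : Fin (m + 1)) : ℝ :=
  (q (b i) (b j) + p (c i j) + (q (b j) (b i) + p (c j i))) / 2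

/-- `I_(a)` in terms of jets. -/
def jetI1 (b : Fin (m + 1) → Pt m) (p : Pt m →L[ℝ] ℝ) : Fin m → ℝ :=
  fun a => p (b a.castSucc) / p (b (Fin.last m))

/-- `I_(ij)` in terms of jets. -/
def jetI2 (b : Fin (m + 1) → Pt m) (c : Fin (m + 1) → Fin (m + 1) → Pt m)
    (p : Pt m →L[ℝ] ℝ) (q : Pt m →L[ℝ] Pt m →L[ℝ] ℝ) : Pairs m → ℝ :=
  fun k =>
    let i := k.1.1
    let j := k.1.2
    (p (b i) ^ 2 * jetW2 b c p q j j - 2 * p (b i) * p (b j) * jetW2 b c p q i j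
      + p (b j) ^ 2 * jetW2 b c p q i i) / p (b (Fin.last m)) ^ 3

/-- Two jets of functions define hypersurfaces with second-order contact. -/
def Contact (p : Pt m →L[ℝ] ℝ) (q : Pt m →L[ℝ] Pt m →L[ℝ] ℝ)
    (p' : Pt m →L[ℝ] ℝ) (q' : Pt m →L[ℝ] Pt m →L[ℝ] ℝ) : Prop :=
  ∃ l : ℝ, l ≠ 0 ∧ (∀ t, p' t = l * p t) ∧ ∀ t, p t = 0 → q' t t = l * q t t

lemma eq_sum_of_mem_ker (b : Module.Basis (Fin (m + 1)) ℝ (Pt m)) (p : Pt m →L[ℝ] ℝ)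
    (hp : p (b (Fin.last m)) ≠ 0) {t : Pt m} (ht : p t = 0) :
    t = ∑ a : Fin m, b.repr t a.castSucc •
      (b a.castSucc - (p (b a.castSucc) / p (b (Fin.last m))) • b (Fin.last m)) := by
  have h := b.sum_repr t
  rw [Fin.sum_univ_castSucc] at h
  have h2 := congrArg p h
  simp only [map_add, map_sum, map_smul, smul_eq_mul, ht] at h2
  have h3 : b.repr t (Fin.last m) =
      -∑ a : Fin m, b.repr t a.castSucc * (p (b a.castSucc) / p (b (Fin.last m))) := by
    rw [← mul_left_inj' hp, neg_mul, Finset.sum_mul]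
    have : ∀ a : Fin m, b.repr t a.castSucc * (p (b a.castSucc) / p (b (Fin.last m))) *
        p (b (Fin.last m)) = b.repr t a.castSucc * p (b a.castSucc) := fun a => by field_simp
    simp only [this]
    linarith
  conv_lhs => rw [← h]
  simp only [smul_sub, Finset.sum_sub_distrib, smul_smul, ← Finset.sum_smul]
  rw [h3, neg_smul, sub_eq_add_neg]

/-- A symmetric bilinear form vanishes on `ker p` if it vanishes on pairs of spanning vectors. -/
lemma quad_eq_of_ker_basis (b : Module.Basis (Fin (m + 1)) ℝ (Pt m)) (p : Pt m →L[ℝ] ℝ)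
    (hp : p (b (Fin.last m)) ≠ 0) (q q' : Pt m →L[ℝ] Pt m →L[ℝ] ℝ) (l : ℝ)
    (h : ∀ a a' : Fin m,
      q' (b a.castSucc - (p (b a.castSucc) / p (b (Fin.last m))) • b (Fin.last m))
        (b a'.castSucc - (p (b a'.castSucc) / p (b (Fin.last m))) • b (Fin.last m)) =
      l * q (b a.castSucc - (p (b a.castSucc) / p (b (Fin.last m))) • b (Fin.last m))
        (b a'.castSucc - (p (b a'.castSucc) / p (b (Fin.last m))) • b (Fin.last m)))
    {t : Pt m} (ht : p t = 0) : q' t t = l * q t t := by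
  rw [eq_sum_of_mem_ker b p hp ht]
  simp only [map_sum, sum_apply, map_smul, smul_apply,
    smul_eq_mul, h, Finset.mul_sum]
  refine Finset.sum_congr rfl fun a _ => Finset.sum_congr rfl fun a' _ => by ring

/-- The vectors e_a - (p_a / p_n) e_n = e_a + u_a e_n are the coordinate tangent vectors of the
graph. In this form the second derivatives of u visibly depend on `q` only through its restriction
to ker `p`. -/
lemma jetHess_eq (p : Pt m →L[ℝ] ℝ) (q : Pt m →L[ℝ] Pt m →L[ℝ] ℝ) (hq : ∀ s t, q s t = q t s)
    (hp : p (Pi.single (Fin.last m) 1) ≠ 0) (a b : Fin m) :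
    jetHess p q a b = -q
      (Pi.single a.castSucc 1 - (p (Pi.single a.castSucc 1) / p (Pi.single (Fin.last m) 1)) •
        Pi.single (Fin.last m) 1)
      (Pi.single b.castSucc 1 - (p (Pi.single b.castSucc 1) / p (Pi.single (Fin.last m) 1)) •
        Pi.single (Fin.last m) 1) / p (Pi.single (Fin.last m) 1) := by
  simp only [jetHess, Matrix.of_apply, map_sub, map_smul, sub_apply,
    smul_apply, smul_eq_mul]
  rw [hq (Pi.single a.castSucc 1) (Pi.single (Fin.last m) 1)]
  field_simp
  ring

lemma jetHess_isSymm (p : Pt m →L[ℝ] ℝ) (q : Pt m →L[ℝ] Pt m →L[ℝ] ℝ)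
    (hq : ∀ s t, q s t = q t s) : (jetHess p q).IsSymm := by
  ext a b
  simp only [jetHess, Matrix.transpose_apply, Matrix.of_apply]
  rw [hq (Pi.single b.castSucc 1) (Pi.single a.castSucc 1)]
  ring

lemma apply_eq_mul_of_basis (b : Module.Basis (Fin (m + 1)) ℝ (Pt m)) (p p' : Pt m →L[ℝ] ℝ)
    (l : ℝ) (h : ∀ i, p' (b i) = l * p (b i)) (t : Pt m) : p' t = l * p t := by
  have : p'.toLinearMap = (l • p).toLinearMap := b.ext fun i => by simpa using h i
  simpa using LinearMap.congr_fun this t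

lemma contact_of_implicit_eq {p p' : Pt m →L[ℝ] ℝ} {q q' : Pt m →L[ℝ] Pt m →L[ℝ] ℝ}
    (hq : ∀ s t, q s t = q t s) (hq' : ∀ s t, q' s t = q' t s)
    (hp : p (Pi.single (Fin.last m) 1) ≠ 0) (hp' : p' (Pi.single (Fin.last m) 1) ≠ 0)
    (h1 : jetGrad p = jetGrad p') (h2 : jetHess p q = jetHess p' q') : Contact p q p' q' := by
  have hg : ∀ a : Fin m, p (Pi.single a.castSucc 1) / p (Pi.single (Fin.last m) 1) =
      p' (Pi.single a.castSucc 1) / p' (Pi.single (Fin.last m) 1) := fun a => by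
    have := congrFun h1 a
    simp only [jetGrad, neg_div, neg_inj] at this
    exact this
  refine ⟨p' (Pi.single (Fin.last m) 1) / p (Pi.single (Fin.last m) 1), div_ne_zero hp' hp,
    apply_eq_mul_of_basis (Pi.basisFun ℝ _) p p' _ fun i => ?_, fun t ht =>
    quad_eq_of_ker_basis (Pi.basisFun ℝ _) p (by simpa using hp) q q' _ (fun a a' => ?_) ht⟩
  · simp only [Pi.basisFun_apply]
    refine Fin.lastCases ?_ (fun a => ?_) i
    · field_simp
    · have := hg a
      field_simp at this ⊢
      linarith
  · simp only [Pi.basisFun_apply]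
    have := congrFun (congrFun h2 a) a'
    rw [jetHess_eq p q hq hp, jetHess_eq p' q' hq' hp', ← hg a, ← hg a'] at this
    rw [div_eq_div_iff hp hp'] at this
    field_simp
    linarith

/-- Polarization on ker `p`: `Contact` compares only the diagonal values, while mixed second
derivatives need two different tangent vectors. -/
lemma Contact.polar {p : Pt m →L[ℝ] ℝ} {q q' : Pt m →L[ℝ] Pt m →L[ℝ] ℝ} {l : ℝ}
    (hq : ∀ s t, q s t = q t s) (hq' : ∀ s t, q' s t = q' t s)
    (h : ∀ t, p t = 0 → q' t t = l * q t t) {s t : Pt m} (hs : p s = 0) (ht : p t = 0) :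
    q' s t = l * q s t := by
  have h1 := h (s + t) (by simp [hs, ht])
  simp only [map_add, add_apply] at h1
  rw [h s hs, h t ht, hq t s, hq' t s] at h1
  linarith

lemma Contact.implicit_eq {p p' : Pt m →L[ℝ] ℝ} {q q' : Pt m →L[ℝ] Pt m →L[ℝ] ℝ}
    (hq : ∀ s t, q s t = q t s) (hq' : ∀ s t, q' s t = q' t s)
    (hp : p (Pi.single (Fin.last m) 1) ≠ 0) (h : Contact p q p' q') :
    jetGrad p' = jetGrad p ∧ jetHess p' q' = jetHess p q := by
  obtain ⟨l, hl, h1, h2⟩ := h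
  have hd : ∀ s, l * p s / (l * p (Pi.single (Fin.last m) 1)) =
      p s / p (Pi.single (Fin.last m) 1) := fun s => by field_simp
  refine ⟨?_, ?_⟩
  · ext a
    simp only [jetGrad, h1]
    field_simp
  · ext a b
    rw [jetHess_eq p q hq hp, jetHess_eq p' q' hq' (by rw [h1]; exact mul_ne_zero hl hp)]
    simp only [h1, hd]
    rw [Contact.polar (p := p) hq hq' h2]
    · field_simp
    · simp [hp]
    · simp [hp]

/-- The vector τ = p(b_i) b_j - p(b_j) b_i lies in ker `p`. The remainder is free of `q` and
homogeneous of degree 3 in `p`, which is why w_(n)³ is the right denominator. -/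
lemma jetI2_num_eq (b : Fin (m + 1) → Pt m) (c : Fin (m + 1) → Fin (m + 1) → Pt m)
    (p : Pt m →L[ℝ] ℝ) (q : Pt m →L[ℝ] Pt m →L[ℝ] ℝ) (hq : ∀ s t, q s t = q t s)
    (i j : Fin (m + 1)) :
    p (b i) ^ 2 * jetW2 b c p q j j - 2 * p (b i) * p (b j) * jetW2 b c p q i j
      + p (b j) ^ 2 * jetW2 b c p q i i =
    q (p (b i) • b j - p (b j) • b i) (p (b i) • b j - p (b j) • b i) +
      (p (b i) ^ 2 * p (c j j) - p (b i) * p (b j) * (p (c i j) + p (c j i))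
        + p (b j) ^ 2 * p (c i i)) := by
  simp only [jetW2, map_sub, map_smul, sub_apply,
    smul_apply, smul_eq_mul]
  rw [hq (b j) (b i)]
  ring

/-- Replacing `p` by `l` times `p` turns τ into l τ, and `q'` contributes one more factor `l` on ker
`p`; numerator and denominator of I_(ij) both acquire l³. -/
lemma Contact.jetI_eq {p p' : Pt m →L[ℝ] ℝ} {q q' : Pt m →L[ℝ] Pt m →L[ℝ] ℝ}
    (b : Fin (m + 1) → Pt m) (c : Fin (m + 1) → Fin (m + 1) → Pt m)
    (hq : ∀ s t, q s t = q t s) (hq' : ∀ s t, q' s t = q' t s) (h : Contact p q p' q') :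
    jetI1 b p' = jetI1 b p ∧ jetI2 b c p' q' = jetI2 b c p q := by
  obtain ⟨l, hl, h1, h2⟩ := h
  refine ⟨?_, ?_⟩
  · ext a
    simp only [jetI1, h1]
    exact mul_div_mul_left _ _ hl
  · ext k
    simp only [jetI2]
    rw [jetI2_num_eq b c p q hq, jetI2_num_eq b c p' q' hq']
    simp only [h1]
    have e : (l * p (b k.1.1)) • b k.1.2 - (l * p (b k.1.2)) • b k.1.1 =
      l • (p (b k.1.1) • b k.1.2 - p (b k.1.2) • b k.1.1) := by
      simp only [smul_sub, smul_smul]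
    rw [e, map_smul, map_smul, smul_apply,
      h2 (p (b k.1.1) • b k.1.2 - p (b k.1.2) • b k.1.1) (by simp; ring), mul_pow l (p (b (Fin.last m)))]
    rw [← mul_div_mul_left _ (p (b (Fin.last m)) ^ 3) (pow_ne_zero 3 hl)]
    congr 1
    simp only [smul_eq_mul]
    ring

/-- The I_(a) fix `p` up to the factor `l`. Let v_a = b_a - (p(b_a) / p(b_n)) b_n, a basis of ker
`p`. The I_(an) determine q(v_a, v_a), and I_(ab) then determines q(v_a, v_b), which it contains
with the coefficient -2 p(b_a) p(b_b); this is where genericity enters. -/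
lemma contact_of_jetI_eq {p p' : Pt m →L[ℝ] ℝ} {q q' : Pt m →L[ℝ] Pt m →L[ℝ] ℝ}
    (b : Module.Basis (Fin (m + 1)) ℝ (Pt m)) (c : Fin (m + 1) → Fin (m + 1) → Pt m)
    (hq : ∀ s t, q s t = q t s) (hq' : ∀ s t, q' s t = q' t s)
    (hp : p (b (Fin.last m)) ≠ 0) (hp' : p' (b (Fin.last m)) ≠ 0)
    (hg : ∀ a a' : Fin m, a < a' → p (b a.castSucc) * p (b a'.castSucc) ≠ 0)
    (h1 : jetI1 b p = jetI1 b p') (h2 : jetI2 b c p q = jetI2 b c p' q') :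
    Contact p q p' q' := by
  obtain ⟨l, hl⟩ : ∃ l, l = p' (b (Fin.last m)) / p (b (Fin.last m)) := ⟨_, rfl⟩
  have hl0 : l ≠ 0 := hl ▸ div_ne_zero hp' hp
  have hpl : ∀ t, p' t = l * p t := apply_eq_mul_of_basis b p p' _ fun i => by
    refine Fin.lastCases ?_ (fun a => ?_) i
    · rw [hl]; field_simp
    · have := congrFun h1 a
      simp only [jetI1] at this
      rw [hl]
      field_simp at this ⊢
      linarith
  have hτ : ∀ i j : Fin (m + 1), i < j →
      q' (p (b i) • b j - p (b j) • b i) (p (b i) • b j - p (b j) • b i) =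
        l * q (p (b i) • b j - p (b j) • b i) (p (b i) • b j - p (b j) • b i) := fun i j hij => by
    have := congrFun h2 ⟨(i, j), hij⟩
    simp only [jetI2] at this
    rw [jetI2_num_eq b c p q hq, jetI2_num_eq b c p' q' hq'] at this
    simp only [hpl] at this
    have e : (l * p (b i)) • b j - (l * p (b j)) • b i =
      l • (p (b i) • b j - p (b j) • b i) := by
      simp only [smul_sub, smul_smul]
    rw [e, map_smul, map_smul, smul_apply, mul_pow l (p (b (Fin.last m))),
      ← mul_div_mul_left _ (p (b (Fin.last m)) ^ 3) (pow_ne_zero 3 hl0),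
      div_left_inj' (mul_ne_zero (pow_ne_zero 3 hl0) (pow_ne_zero 3 hp))] at this
    simp only [smul_eq_mul] at this
    -- The frame terms scale by l³ and cancel; what remains is l² q'(τ, τ) = l³ q(τ, τ).
    have h3 : l ^ 2 * (l * q (p (b i) • b j - p (b j) • b i) (p (b i) • b j - p (b j) • b i) -
      q' (p (b i) • b j - p (b j) • b i) (p (b i) • b j - p (b j) • b i)) = 0 := by
      linear_combination this
    have := (mul_eq_zero.mp h3).resolve_left (pow_ne_zero 2 hl0)
    linarith
  refine ⟨l, hl0, hpl, fun t ht => quad_eq_of_ker_basis b p hp q q' _ ?_ ht⟩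
  obtain ⟨v, hv⟩ : ∃ v : Fin m → Pt m, ∀ a, v a =
    b a.castSucc - (p (b a.castSucc) / p (b (Fin.last m))) • b (Fin.last m) := ⟨_, fun _ => rfl⟩
  simp only [← hv]
  have hdiag : ∀ a, q' (v a) (v a) = l * q (v a) (v a) := fun a => by
    have h := hτ a.castSucc (Fin.last m) (Fin.castSucc_lt_last a)
    have e : p (b a.castSucc) • b (Fin.last m) - p (b (Fin.last m)) • b a.castSucc =
        (-p (b (Fin.last m))) • v a := by
      rw [hv, smul_sub, smul_smul, neg_mul, mul_div_cancel₀ _ hp]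
      simp only [neg_smul]
      abel
    rw [e] at h
    simp only [map_smul, smul_apply, smul_eq_mul] at h
    have h3 : p (b (Fin.last m)) ^ 2 * (q' (v a) (v a) - l * q (v a) (v a)) = 0 := by
      linear_combination h
    have := (mul_eq_zero.mp h3).resolve_left (pow_ne_zero 2 hp)
    linarith
  have hlt : ∀ a a', a < a' → q' (v a) (v a') = l * q (v a) (v a') := fun a a' haa => by
    have h := hτ a.castSucc a'.castSucc (Fin.castSucc_lt_castSucc_iff.mpr haa)
    -- The b_n components cancel, so τ is a combination of v_a and v_a'. Expanding its square and
    -- removing the known diagonal terms isolates the mixed one.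
    have e : p (b a.castSucc) • b a'.castSucc - p (b a'.castSucc) • b a.castSucc =
        p (b a.castSucc) • v a' - p (b a'.castSucc) • v a := by
      rw [hv, hv, smul_sub, smul_sub, smul_smul, smul_smul]
      rw [show p (b a.castSucc) * (p (b a'.castSucc) / p (b (Fin.last m))) =
        p (b a'.castSucc) * (p (b a.castSucc) / p (b (Fin.last m))) by ring]
      abel
    rw [e] at h
    simp only [map_sub, map_smul, sub_apply, smul_apply,
      smul_eq_mul] at h
    rw [hdiag, hdiag, hq (v a') (v a), hq' (v a') (v a)] at h
    have h3 : (p (b a.castSucc) * p (b a'.castSucc)) *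
      (q' (v a) (v a') - l * q (v a) (v a')) = 0 := by linear_combination (-1 / 2) * h
    have := (mul_eq_zero.mp h3).resolve_left (hg a a' haa)
    linarith
  intro a a'
  rcases lt_trichotomy a a' with h | h | h
  · exact hlt a a' h
  · subst h; exact hdiag a
  · rw [hq (v a), hq' (v a)]; exact hlt a' a h

end

/-! ### Inverse functions, coordinates and implicit differentiation. -/

section

variable {m : ℕ}

/-- The inverse function theorem on open sets. -/
lemma exists_openPartialHomeomorph {E F : Type*} [NormedAddCommGroup E] [NormedSpace ℝ E]
    [CompleteSpace E] [NormedAddCommGroup F] [NormedSpace ℝ F] {n : WithTop ℕ∞}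
    (hn : 1 ≤ n) {f : E → F} {U : Set E} (hU : IsOpen U) (hf : ContDiffOn ℝ n f U) {x : E}
    (hx : x ∈ U) (f' : E ≃L[ℝ] F) (hf' : fderiv ℝ f x = f') :
    ∃ Φ : OpenPartialHomeomorph E F, x ∈ Φ.source ∧ Φ.source ⊆ U ∧ (∀ y, Φ y = f y) ∧
      ContDiffOn ℝ n Φ.symm Φ.target := by
  have hn0 : n ≠ 0 := fun h => by simp [h] at hn
  have hfx : ContDiffAt ℝ n f x := hf.contDiffAt (hU.mem_nhds hx)
  have hd : HasFDerivAt f (f' : E →L[ℝ] F) x := hf' ▸ (hfx.differentiableAt hn0).hasFDerivAt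
  obtain ⟨Φ, hΦ⟩ : ∃ Φ, Φ = hfx.toOpenPartialHomeomorph f hd hn0 := ⟨_, rfl⟩
  have hΦf : (Φ : E → F) = f := hΦ ▸ hfx.toOpenPartialHomeomorph_coe hd hn0
  have hxs : x ∈ Φ.source := hΦ ▸ hfx.mem_toOpenPartialHomeomorph_source hd hn0
  -- Restricting to the open set where the derivative stays invertible makes the inverse regular on
  -- the whole target, not only near the image of `x`.
  have hV : IsOpen (U ∩ fderiv ℝ f ⁻¹' Set.range ((↑) : (E ≃L[ℝ] F) → E →L[ℝ] F)) :=
    (hf.continuousOn_fderiv_of_isOpen hU hn).isOpen_inter_preimage hU ContinuousLinearEquiv.isOpen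
  obtain ⟨V, hVd⟩ : ∃ V, V = U ∩ fderiv ℝ f ⁻¹' Set.range ((↑) : (E ≃L[ℝ] F) → E →L[ℝ] F) :=
    ⟨_, rfl⟩
  rw [← hVd] at hV
  have hxV : x ∈ V := by rw [hVd]; exact ⟨hx, f', hf'.symm⟩
  refine ⟨Φ.restrOpen V hV, ⟨hxs, hxV⟩, fun y hy => ?_, fun y => congrFun hΦf y, fun y hy => ?_⟩
  · have : y ∈ V := hy.2
    rw [hVd] at this
    exact this.1
  · have hs : (Φ.restrOpen V hV).symm y ∈ V := ((Φ.restrOpen V hV).map_target hy).2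
    obtain ⟨hsU, g, hg⟩ := hVd.subset hs
    have hc : ContDiffAt ℝ n f ((Φ.restrOpen V hV).symm y) := hf.contDiffAt (hU.mem_nhds hsU)
    refine (OpenPartialHomeomorph.contDiffAt_symm _ hy (f₀' := g) ?_ ?_).contDiffWithinAt
    · have := (hc.differentiableAt hn0).hasFDerivAt
      rw [← hg] at this
      exact this.congr_of_eventuallyEq (Eventually.of_forall fun y => congrFun hΦf y)
    · exact hc.congr_of_eventuallyEq (Eventually.of_forall fun y => congrFun hΦf y)

/-- An injective endomorphism in finite dimension, as an equivalence. -/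
lemma exists_equiv_of_injective {E F : Type*} [NormedAddCommGroup E] [NormedSpace ℝ E]
    [FiniteDimensional ℝ E] [NormedAddCommGroup F] [NormedSpace ℝ F] [FiniteDimensional ℝ F]
    (hd : Module.finrank ℝ E = Module.finrank ℝ F) (f : E →L[ℝ] F)
    (hf : ∀ v, f v = 0 → v = 0) : ∃ f' : E ≃L[ℝ] F, f = f' := by
  refine ⟨(LinearEquiv.ofInjectiveOfFinrankEq f.toLinearMap
    ((injective_iff_map_eq_zero f.toLinearMap).mpr hf) hd).toContinuousLinearEquiv, ?_⟩
  ext v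
  rfl

/-- `pt` as a continuous linear map. -/
def ptL (m : ℕ) : (Fin m → ℝ) × ℝ →L[ℝ] Pt m :=
  LinearMap.toContinuousLinearMap
    { toFun := fun y => pt y.1 y.2
      map_add' := fun y y' => by
        ext i
        refine Fin.lastCases ?_ (fun a => ?_) i <;> simp [pt]
      map_smul' := fun c y => by
        ext i
        refine Fin.lastCases ?_ (fun a => ?_) i <;> simp [pt] }

/-- The projection `z = (x, u) ↦ x`. -/
def initL (m : ℕ) : Pt m →L[ℝ] (Fin m → ℝ) :=
  LinearMap.toContinuousLinearMap
    { toFun := fun z a => z a.castSucc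
      map_add' := fun _ _ => rfl
      map_smul' := fun _ _ => rfl }

/-- The projection `z = (x, u) ↦ u`. -/
def lastL (m : ℕ) : Pt m →L[ℝ] ℝ := ContinuousLinearMap.proj (Fin.last m)

@[simp] lemma ptL_apply (x : Fin m → ℝ) (u : ℝ) : ptL m (x, u) = pt x u := rfl

@[simp] lemma initL_pt (x : Fin m → ℝ) (u : ℝ) : initL m (pt x u) = x := by
  ext a; simp [initL, pt]

@[simp] lemma lastL_pt (x : Fin m → ℝ) (u : ℝ) : lastL m (pt x u) = u := by simp [lastL, pt]

@[simp] lemma pt_initL_lastL (z : Pt m) : pt (initL m z) (lastL m z) = z := by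
  ext i
  refine Fin.lastCases ?_ (fun a => ?_) i <;> simp [pt, initL, lastL]

lemma pt_single (a : Fin m) (c : ℝ) :
    pt (Pi.single a 1) c = Pi.single a.castSucc 1 + c • Pi.single (Fin.last m) 1 := by
  ext i
  refine Fin.lastCases ?_ (fun a' => ?_) i
  · simp [pt, (Fin.castSucc_lt_last a).ne']
  · simp [pt, Pi.single_apply, (Fin.castSucc_lt_last a').ne]

lemma eq_smul_single_of_initL {v : Pt m} (hv : initL m v = 0) :
    v = lastL m v • Pi.single (Fin.last m) 1 := by
  ext i
  refine Fin.lastCases ?_ (fun a => ?_) i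
  · simp [lastL]
  · have : v a.castSucc = 0 := congrFun hv a
    simp [this, (Fin.castSucc_lt_last a).ne]

lemma contDiffAt_pt {n : WithTop ℕ∞} {E : Type*} [NormedAddCommGroup E] [NormedSpace ℝ E]
    {f : E → Fin m → ℝ} {g : E → ℝ} {x : E} (hf : ContDiffAt ℝ n f x) (hg : ContDiffAt ℝ n g x) :
    ContDiffAt ℝ n (fun y => pt (f y) (g y)) x :=
  (ptL m).contDiff.contDiffAt.comp x (hf.prodMk hg)

/-! ### Derivatives of the defining function -/

lemma pd_pd {w : Pt m → ℝ} {z : Pt m} (hw : ContDiffAt ℝ 2 w z) (i j : Fin (m + 1)) :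
    pd i (pd j w) z = fderiv ℝ (fderiv ℝ w) z (Pi.single i 1) (Pi.single j 1) := by
  have h : DifferentiableAt ℝ (fderiv ℝ w) z :=
    (hw.fderiv_right (m := 1) (by norm_num)).differentiableAt (by norm_num)
  change fderiv ℝ (fun y => fderiv ℝ w y (Pi.single j 1)) z (Pi.single i 1) = _
  rw [fderiv_clm_apply h (by fun_prop)]
  simp

lemma implicitGrad_eq (w : Pt m → ℝ) (z : Pt m) : implicitGrad w z = jetGrad (fderiv ℝ w z) := rfl

lemma implicitHess_eq {w : Pt m → ℝ} {z : Pt m} (hw : ContDiffAt ℝ 2 w z) :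
    implicitHess w z = jetHess (fderiv ℝ w z) (fderiv ℝ (fderiv ℝ w) z) := by
  ext a b
  simp only [implicitHess, jetHess, Matrix.of_apply, pd_pd hw]
  rfl

lemma symm_snd {w : Pt m → ℝ} {z : Pt m} (hw : ContDiffAt ℝ 2 w z) (s t : Pt m) :
    fderiv ℝ (fderiv ℝ w) z s t = fderiv ℝ (fderiv ℝ w) z t s :=
  (hw.isSymmSndFDerivAt (by simp)).eq s t

/-! ### Implicit functions -/

/-- The map (x, u) ↦ (x, w(x, u)) is a local diffeomorphism because w_n ≠ 0; its inverse along the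
slice of second coordinate 0 is the graph. -/
lemma exists_implicit {r : ℕ∞} (hr : 2 ≤ r) {Z V : Set (Pt m)} {w : Pt m → ℝ} (hV : IsOpen V)
    (hVZ : V ⊆ Z) (hw : ContDiffOn ℝ r w V) {z : Pt m} (hz : z ∈ V) (hwz : w z = 0)
    (hn : pd (Fin.last m) w z ≠ 0) :
    ∃ Ω u, IsFunctionIn r Z Ω u ∧ graph Ω u ⊆ {y ∈ V | w y = 0} ∧ ∃ x ∈ Ω, pt x (u x) = z := by
  have hr1 : (1 : WithTop ℕ∞) ≤ (r : WithTop ℕ∞) := by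
    have : (1 : ℕ∞) ≤ r := le_trans (by norm_num) hr
    exact_mod_cast this
  have hΨ : ContDiffOn ℝ r (fun y => pt (initL m y) (w y)) V := fun y hy =>
    (contDiffAt_pt (initL m).contDiff.contDiffAt
      (hw.contDiffAt (hV.mem_nhds hy))).contDiffWithinAt
  have hwd : DifferentiableAt ℝ w z :=
    (hw.contDiffAt (hV.mem_nhds hz)).differentiableAt (by intro h; simp [h] at hr1)
  have hΨ' : HasFDerivAt (fun y => pt (initL m y) (w y))
      ((ptL m).comp ((initL m).prod (fderiv ℝ w z))) z :=
    (ptL m).hasFDerivAt.comp z ((initL m).hasFDerivAt.prodMk hwd.hasFDerivAt)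
  obtain ⟨f', hf'⟩ := exists_equiv_of_injective rfl ((ptL m).comp ((initL m).prod (fderiv ℝ w z)))
    (fun v hv => by
      have h0 : pt (initL m v) (fderiv ℝ w z v) = 0 := hv
      have h1 : initL m v = 0 := by simpa using congrArg (initL m) h0
      have h2 : fderiv ℝ w z v = 0 := by simpa using congrArg (lastL m) h0
      rw [eq_smul_single_of_initL h1, map_smul, smul_eq_mul] at h2
      have h3 := (mul_eq_zero.mp h2).resolve_right hn
      rw [eq_smul_single_of_initL h1, h3, zero_smul])
  obtain ⟨Φ, hzΦ, hΦV, hΦ, hΦs⟩ := exists_openPartialHomeomorph hr1 hV hΨ hz f'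
    (hΨ'.fderiv.trans hf')
  have key : ∀ x, pt x 0 ∈ Φ.target → Φ.symm (pt x 0) ∈ V ∧ w (Φ.symm (pt x 0)) = 0 ∧
      pt x (lastL m (Φ.symm (pt x 0))) = Φ.symm (pt x 0) := fun x hx => by
    have h1 := Φ.right_inv hx
    rw [hΦ] at h1
    have h2 : initL m (Φ.symm (pt x 0)) = x := by simpa using congrArg (initL m) h1
    have h3 : w (Φ.symm (pt x 0)) = 0 := by simpa using congrArg (lastL m) h1
    refine ⟨hΦV (Φ.map_target hx), h3, ?_⟩
    have h4 := pt_initL_lastL (Φ.symm (pt x 0))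
    rwa [h2] at h4
  have hz0 : pt (initL m z) 0 = Φ z := by rw [hΦ, hwz]
  have hcont : ContDiff ℝ r (fun x : Fin m → ℝ => pt x (0 : ℝ)) :=
    (ptL m).contDiff.comp (contDiff_id.prodMk contDiff_const)
  refine ⟨(fun x => pt x 0) ⁻¹' Φ.target, fun x => lastL m (Φ.symm (pt x 0)), ⟨?_, ?_, ?_⟩, ?_,
    initL m z, ?_, ?_⟩
  · exact Φ.open_target.preimage hcont.continuous
  · exact (lastL m).contDiff.comp_contDiffOn
      (hΦs.comp hcont.contDiffOn (fun x hx => hx))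
  · rintro _ ⟨x, hx, rfl⟩
    simp only [(key x hx).2.2]
    exact hVZ (key x hx).1
  · rintro _ ⟨x, hx, rfl⟩
    simp only [(key x hx).2.2]
    exact ⟨(key x hx).1, (key x hx).2.1⟩
  · simp only [Set.mem_preimage, hz0]
    exact Φ.map_source hzΦ
  · simp only [hz0, Φ.left_inv hzΦ, pt_initL_lastL]

/-- Implicit differentiation, first order. -/
lemma grad_eq_implicitGrad {u : (Fin m → ℝ) → ℝ} {w : Pt m → ℝ} {x : Fin m → ℝ}
    (hu : DifferentiableAt ℝ u x) (hw : DifferentiableAt ℝ w (pt x (u x)))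
    (h0 : ∀ᶠ y in 𝓝 x, w (pt y (u y)) = 0) (hn : pd (Fin.last m) w (pt x (u x)) ≠ 0) :
    grad u x = implicitGrad w (pt x (u x)) := by
  have hd : HasFDerivAt (fun y => w (pt y (u y)))
      ((fderiv ℝ w (pt x (u x))).comp
        ((ptL m).comp ((ContinuousLinearMap.id ℝ _).prod (fderiv ℝ u x)))) x :=
    hw.hasFDerivAt.comp x ((ptL m).hasFDerivAt.comp x ((hasFDerivAt_id x).prodMk hu.hasFDerivAt))
  have hz : HasFDerivAt (fun y => w (pt y (u y))) (0 : (Fin m → ℝ) →L[ℝ] ℝ) x :=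
    (hasFDerivAt_const (0 : ℝ) x).congr_of_eventuallyEq h0
  ext a
  have h := DFunLike.congr_fun (hd.unique hz) (Pi.single a 1)
  simp only [ContinuousLinearMap.comp_apply, ContinuousLinearMap.prod_apply,
    ContinuousLinearMap.id_apply, ptL_apply, pt_single, map_add, map_smul, smul_eq_mul,
    zero_apply] at h
  simp only [grad, implicitGrad, pd] at hn ⊢
  rw [eq_div_iff hn]
  linarith

/-- Implicit differentiation, second order. -/
lemma hess_eq_implicitHess {u : (Fin m → ℝ) → ℝ} {w : Pt m → ℝ} {x : Fin m → ℝ}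
    (hu : ContDiffAt ℝ 2 u x) (hw : ContDiffAt ℝ 2 w (pt x (u x)))
    (h0 : ∀ᶠ y in 𝓝 x, w (pt y (u y)) = 0) (hn : pd (Fin.last m) w (pt x (u x)) ≠ 0) :
    hess u x = implicitHess w (pt x (u x)) := by
  have hud : DifferentiableAt ℝ u x := hu.differentiableAt (by norm_num)
  have hc : ContinuousAt (fun y => pt y (u y)) x :=
    (contDiffAt_pt contDiffAt_id hu).continuousAt
  have hP : HasFDerivAt (fun y => pt y (u y))
      ((ptL m).comp ((ContinuousLinearMap.id ℝ _).prod (fderiv ℝ u x))) x :=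
    (ptL m).hasFDerivAt.comp x ((hasFDerivAt_id x).prodMk hud.hasFDerivAt)
  have hwd : ContDiffAt ℝ 1 (fderiv ℝ w) (pt x (u x)) := hw.fderiv_right (by norm_num)
  have hpdd : ∀ i, DifferentiableAt ℝ (pd i w) (pt x (u x)) := fun i =>
    ((hwd.differentiableAt (by norm_num)).clm_apply (by fun_prop) :
      DifferentiableAt ℝ (fun y => fderiv ℝ w y (Pi.single i 1)) _)
  have hne : ∀ᶠ y in 𝓝 x, pd (Fin.last m) w (pt y (u y)) ≠ 0 :=
    (ContinuousAt.comp (f := fun y => pt y (u y)) (g := pd (Fin.last m) w) (x := x)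
      (hpdd _).continuousAt hc).eventually_ne hn
  have hev : ∀ᶠ y in 𝓝 x, grad u y = implicitGrad w (pt y (u y)) := by
    have h1 := hu.eventually (by simp)
    have h2 := hc.eventually (hw.eventually (by simp))
    filter_upwards [h1, h2, h0.eventually_nhds, hne] with y hy1 hy2 hy3 hy4
    exact grad_eq_implicitGrad (hy1.differentiableAt (by norm_num))
      (hy2.differentiableAt (by norm_num)) hy3 hy4
  have hg := hev.self_of_nhds
  ext a b
  -- The identity u_b w_n = -w_b along the graph is differentiated in product form, which avoids
  -- differentiating a quotient.
  have hb : (fun y => pd b u y * pd (Fin.last m) w (pt y (u y))) =ᶠ[𝓝 x]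
      fun y => -pd b.castSucc w (pt y (u y)) := by
    filter_upwards [hev, hne] with y hy hy'
    have : pd b u y = -pd b.castSucc w (pt y (u y)) / pd (Fin.last m) w (pt y (u y)) :=
      congrFun hy b
    rw [this, div_mul_cancel₀ _ hy']
  have hub : DifferentiableAt ℝ (pd b u) x :=
    (((hu.fderiv_right (m := 1) (by norm_num)).differentiableAt (by norm_num)).clm_apply
      (by fun_prop) : DifferentiableAt ℝ (fun y => fderiv ℝ u y (Pi.single b 1)) x)
  have hD : ∀ i, HasFDerivAt (fun y => pd i w (pt y (u y)))
      ((fderiv ℝ (pd i w) (pt x (u x))).comp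
        ((ptL m).comp ((ContinuousLinearMap.id ℝ _).prod (fderiv ℝ u x)))) x := fun i =>
    HasFDerivAt.comp (f := fun y => pt y (u y)) (g := pd i w) x (hpdd i).hasFDerivAt hP
  have hga : fderiv ℝ u x (Pi.single a 1) =
      -pd a.castSucc w (pt x (u x)) / pd (Fin.last m) w (pt x (u x)) := congrFun hg a
  have hs : ∀ i, fderiv ℝ (pd i w) (pt x (u x)) (pt (Pi.single a 1) (fderiv ℝ u x (Pi.single a 1)))
      = pd a.castSucc (pd i w) (pt x (u x)) + fderiv ℝ u x (Pi.single a 1) *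
        pd (Fin.last m) (pd i w) (pt x (u x)) := fun i => by
    rw [pt_single, map_add, map_smul, smul_eq_mul]
    rfl
  have hsym : pd a.castSucc (pd (Fin.last m) w) (pt x (u x)) =
      pd (Fin.last m) (pd a.castSucc w) (pt x (u x)) := by
    rw [pd_pd hw, pd_pd hw, symm_snd hw]
  have hgb : pd b u x = -pd b.castSucc w (pt x (u x)) / pd (Fin.last m) w (pt x (u x)) :=
    congrFun hg b
  have h := DFunLike.congr_fun ((hub.hasFDerivAt.mul (hD (Fin.last m))).unique
    ((hD b.castSucc).neg.congr_of_eventuallyEq hb)) (Pi.single a 1)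
  simp only [smul_apply, add_apply, neg_apply, ContinuousLinearMap.comp_apply,
    ContinuousLinearMap.prod_apply,
    ContinuousLinearMap.id_apply, ptL_apply, hs, smul_eq_mul] at h
  rw [hga, hgb, hsym] at h
  have e : hess u x a b = fderiv ℝ (pd b u) x (Pi.single a 1) := rfl
  rw [e]
  simp only [implicitHess, Matrix.of_apply]
  field_simp at h ⊢
  linear_combination h

end

/-! ### Local actions, right-invariant fields and the invariance of the I's. -/

section

variable {m : ℕ} {G : Type*} [Group G] [TopologicalSpace G]
  [ChartedSpace (EuclideanSpace ℝ (Fin (m + 1))) G] {Z : Set (Pt m)}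

lemma two_le_smooth : (2 : WithTop ℕ∞) ≤ ∞ :=
  WithTop.coe_le_coe.mpr (le_top : (2 : ℕ∞) ≤ ⊤)

namespace LocalAction

lemma eventually_dom (A : LocalAction G Z) {g : G} {z : Pt m} (h : (g, z) ∈ A.dom) :
    ∀ᶠ y in 𝓝 z, (g, y) ∈ A.dom :=
  (Continuous.prodMk_right g).continuousAt.eventually (A.isOpen_dom.mem_nhds h)

lemma contDiffAt_act (A : LocalAction G Z) {g : G} {z : Pt m} (h : (g, z) ∈ A.dom) :
    ContDiffAt ℝ ∞ (A.act g) z := by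
  have h1 := A.smooth.contMDiffAt (A.isOpen_dom.mem_nhds h)
  have h2 : ContMDiffAt 𝓘(ℝ, Pt m) ((𝓡 (m + 1)).prod 𝓘(ℝ, Pt m)) ∞
      (fun y : Pt m => (g, y)) z := contMDiffAt_const.prodMk contMDiffAt_id
  exact contMDiffAt_iff_contDiffAt.mp
    (ContMDiffAt.comp (g := fun p : G × Pt m => A.act p.1 p.2) z h1 h2)

lemma inv_act (A : LocalAction G Z) {g : G} {z : Pt m} (h : (g, z) ∈ A.dom) :
    A.act g⁻¹ (A.act g z) = z := by
  rw [← A.mul_act h (A.inv_mem h), inv_mul_cancel, A.one_act (A.mem_of_dom h)]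

lemma fderiv_act_inv (A : LocalAction G Z) {g : G} {z : Pt m} (h : (g, z) ∈ A.dom) (v : Pt m) :
    fderiv ℝ (A.act g⁻¹) (A.act g z) (fderiv ℝ (A.act g) z v) = v := by
  have h1 := ((A.contDiffAt_act (A.inv_mem h)).differentiableAt (by simp)).hasFDerivAt.comp z
    ((A.contDiffAt_act h).differentiableAt (by simp)).hasFDerivAt
  have h2 : HasFDerivAt (A.act g⁻¹ ∘ A.act g) (ContinuousLinearMap.id ℝ (Pt m)) z :=
    (hasFDerivAt_id z).congr_of_eventuallyEq ((A.eventually_dom h).mono fun y hy => A.inv_act hy)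
  exact DFunLike.congr_fun (h1.unique h2) v

variable {A : LocalAction G Z}

lemma IsSimplyTransitive.elt_spec (hA : A.IsSimplyTransitive) {z₀ z : Pt m} (hz₀ : z₀ ∈ Z)
    (hz : z ∈ Z) : (A.elt z₀ z, z₀) ∈ A.dom ∧ A.act (A.elt z₀ z) z₀ = z :=
  Classical.epsilon_spec (p := fun g : G => (g, z₀) ∈ A.dom ∧ A.act g z₀ = z)
    (hA.existsUnique z₀ hz₀ z hz).exists

lemma IsSimplyTransitive.elt_eq (hA : A.IsSimplyTransitive) {z₀ : Pt m} {g : G}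
    (h : (g, z₀) ∈ A.dom) : A.elt z₀ (A.act g z₀) = g :=
  (hA.existsUnique z₀ (A.mem_of_dom h) _ (A.act_mem h)).unique
    (hA.elt_spec (A.mem_of_dom h) (A.act_mem h)) ⟨h, rfl⟩

/-- Right-invariant vector fields are invariant under the action. -/
lemma IsSimplyTransitive.rightInvariant_act (hA : A.IsSimplyTransitive) {z₀ : Pt m}
    (hz₀ : z₀ ∈ Z) (e : Pt m) {g : G} {z : Pt m} (h : (g, z) ∈ A.dom) :
    A.rightInvariant z₀ e (A.act g z) = fderiv ℝ (A.act g) z (A.rightInvariant z₀ e z) := by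
  obtain ⟨h1, h2⟩ := hA.elt_spec hz₀ (A.mem_of_dom h)
  have h' : (g, A.act (A.elt z₀ z) z₀) ∈ A.dom := by rwa [h2]
  have h3 : A.elt z₀ (A.act g z) = g * A.elt z₀ z := by
    have := hA.elt_eq (A.mul_mem h1 h')
    rwa [A.mul_act h1 h', h2] at this
  have h4 : A.act (g * A.elt z₀ z) =ᶠ[𝓝 z₀] A.act g ∘ A.act (A.elt z₀ z) := by
    filter_upwards [A.eventually_dom h1,
      (A.contDiffAt_act h1).continuousAt.eventually (A.eventually_dom h')] with y hy hy'
    exact A.mul_act hy hy'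
  rw [rightInvariant, rightInvariant, h3, h4.fderiv_eq, fderiv_comp]
  · simp [h2]
  · exact (A.contDiffAt_act h').differentiableAt (by simp)
  · exact (A.contDiffAt_act h1).differentiableAt (by simp)

lemma IsSimplyTransitive.exists_basis (hA : A.IsSimplyTransitive) {z₀ : Pt m} (hz₀ : z₀ ∈ Z)
    (e : Module.Basis (Fin (m + 1)) ℝ (Pt m)) {z : Pt m} (hz : z ∈ Z) :
    ∃ b : Module.Basis (Fin (m + 1)) ℝ (Pt m), ∀ i, b i = A.rightInvariant z₀ (e i) z := by
  obtain ⟨h1, -⟩ := hA.elt_spec hz₀ hz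
  obtain ⟨f, hf⟩ := exists_equiv_of_injective rfl (fderiv ℝ (A.act (A.elt z₀ z)) z₀) fun v hv => by
    rw [← A.fderiv_act_inv h1 v, hv, map_zero]
  refine ⟨e.map f.toLinearEquiv, fun i => ?_⟩
  rw [rightInvariant, hf]
  rfl

/-- The element carrying `z₀` to a point is chosen by `Classical.epsilon`, with no smoothness given.
By the rank condition the orbit map at `z` is a local diffeomorphism at the identity of G, so points
z' near `z` are reached by group elements depending smoothly on z'; invariance then expresses the
field at z' through its single value at `z`. -/
lemma IsSimplyTransitive.differentiableAt_rightInvariant [LieGroup (𝓡 (m + 1)) ∞ G]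
    (hA : A.IsSimplyTransitive) {z₀ : Pt m} (hz₀ : z₀ ∈ Z) (e : Pt m) {z : Pt m} (hz : z ∈ Z) :
    DifferentiableAt ℝ (A.rightInvariant z₀ e) z := by
  have : IsManifold (𝓡 (m + 1)) ∞ G := inferInstance
  obtain ⟨φ, hφ⟩ : ∃ φ, φ = extChartAt (𝓡 (m + 1)) (1 : G) := ⟨_, rfl⟩
  have hs1 : φ.symm (φ 1) = 1 := by rw [hφ]; exact extChartAt_to_inv 1
  have htarget : φ.target ∈ 𝓝 (φ 1) := by rw [hφ]; exact extChartAt_target_mem_nhds 1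
  have hsymm : ContMDiffAt 𝓘(ℝ, EuclideanSpace ℝ (Fin (m + 1))) (𝓡 (m + 1)) ∞ φ.symm (φ 1) := by
    rw [hφ] at htarget ⊢
    exact (contMDiffOn_extChartAt_symm 1).contMDiffAt htarget
  have hdom : (φ.symm (φ 1), z) ∈ A.dom := by rw [hs1]; exact A.one_mem hz
  have hact := A.smooth.contMDiffAt (A.isOpen_dom.mem_nhds hdom)
  have hΦ : ContDiffAt ℝ ∞ (fun p : EuclideanSpace ℝ (Fin (m + 1)) × Pt m =>
      A.act (φ.symm p.1) p.2) (φ 1, z) := by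
    rw [← contMDiffAt_iff_contDiffAt]
    exact ContMDiffAt.comp (g := fun p : G × Pt m => A.act p.1 p.2)
      (f := fun p : EuclideanSpace ℝ (Fin (m + 1)) × Pt m => (φ.symm p.1, p.2)) (φ 1, z) hact
      ((ContMDiffAt.comp (g := φ.symm) (φ 1, z) hsymm contDiff_fst.contMDiff.contMDiffAt).prodMk
        contDiff_snd.contMDiff.contMDiffAt)
  have hh : ContDiffAt ℝ ∞ (fun y => A.act (φ.symm y) z) (φ 1) :=
    ContDiffAt.comp (g := fun p : EuclideanSpace ℝ (Fin (m + 1)) × Pt m =>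
      A.act (φ.symm p.1) p.2) (φ 1) hΦ (contDiffAt_id.prodMk contDiffAt_const)
  have hgen : ∀ v, A.generator v z = fderiv ℝ (fun y => A.act (φ.symm y) z) (φ 1) v := by
    intro v
    have hsm : ContMDiffAt (𝓡 (m + 1)) 𝓘(ℝ, Pt m) ∞ (fun g : G => A.act g z) 1 :=
      ContMDiffAt.comp (g := fun p : G × Pt m => A.act p.1 p.2) (1 : G)
        (A.smooth.contMDiffAt (A.isOpen_dom.mem_nhds (A.one_mem hz)))
        (contMDiffAt_id.prodMk contMDiffAt_const)
    have hmd : MDifferentiableAt (𝓡 (m + 1)) 𝓘(ℝ, Pt m) (fun g : G => A.act g z) 1 :=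
      hsm.mdifferentiableAt (by simp)
    rw [generator, hmd.mfderiv, hφ]
    simp only [modelWithCornersSelf_coe, Set.range_id, fderivWithin_univ]
    rfl
  obtain ⟨f', hf'⟩ := exists_equiv_of_injective (by simp)
    (fderiv ℝ (fun y => A.act (φ.symm y) z) (φ 1)) fun v hv => by
      apply (hA.rank z hz).injective
      exact (hgen v).trans (hv.trans ((map_zero _).symm.trans (hgen 0).symm))
  have hfd : HasFDerivAt (fun y => A.act (φ.symm y) z)
      (f' : EuclideanSpace ℝ (Fin (m + 1)) →L[ℝ] Pt m) (φ 1) :=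
    hf' ▸ (hh.differentiableAt (by simp)).hasFDerivAt
  have hval : A.act (φ.symm (φ 1)) z = z := by rw [hs1, A.one_act hz]
  -- `σ` is the local inverse of the orbit map in the chart `φ`: the element `φ.symm (σ y)` carries
  -- `z` to `y`.
  obtain ⟨σ, hσ1, hσc, hσr⟩ : ∃ σ : Pt m → EuclideanSpace ℝ (Fin (m + 1)), σ z = φ 1 ∧
      ContDiffAt ℝ ∞ σ z ∧ ∀ᶠ y in 𝓝 z, A.act (φ.symm (σ y)) z = y := by
    have hst := hh.hasStrictFDerivAt' hfd (by simp)
    refine ⟨hh.localInverse hfd (by simp), ?_, ?_, ?_⟩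
    · have := hst.localInverse_apply_image
      simp only [hval] at this
      exact this
    · have := hh.to_localInverse hfd (by simp)
      rwa [hval] at this
    · have := hst.eventually_right_inverse
      simp only [hval] at this
      exact this
  have hγ : ContDiffAt ℝ 1 (fun z' => fderiv ℝ (A.act (φ.symm (σ z'))) z) z := by
    refine ContDiffAt.fderiv (f := fun z' y => A.act (φ.symm (σ z')) y) (g := fun _ => z)
      (n := ∞) ?_ contDiffAt_const 
      (by rw [one_add_one_eq_two]; exact two_le_smooth)
    rw [← hσ1] at hΦ
    exact ContDiffAt.comp (g := fun p : EuclideanSpace ℝ (Fin (m + 1)) × Pt m =>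
      A.act (φ.symm p.1) p.2) (f := fun p : Pt m × Pt m => (σ p.1, p.2)) (z, z) hΦ
      ((ContDiffAt.comp (g := σ) (z, z) hσc contDiffAt_fst).prodMk contDiffAt_snd)
  have hdom' : ∀ᶠ y in 𝓝 z, (φ.symm (σ y), z) ∈ A.dom := by
    have hc : ContinuousAt (fun y => (φ.symm (σ y), z)) z := by
      refine ContinuousAt.prodMk (ContinuousAt.comp (g := φ.symm) ?_ hσc.continuousAt)
        continuousAt_const
      rw [hσ1]
      exact hsymm.continuousAt
    exact hc.eventually (A.isOpen_dom.mem_nhds (by simpa only [hσ1] using hdom))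
  have hev : A.rightInvariant z₀ e =ᶠ[𝓝 z]
      fun z' => fderiv ℝ (A.act (φ.symm (σ z'))) z (A.rightInvariant z₀ e z) := by
    filter_upwards [hσr, hdom'] with y hy hy'
    rw [← hA.rightInvariant_act hz₀ e hy', hy]
  exact ((hγ.differentiableAt (by simp)).clm_apply
    (differentiableAt_const _)).congr_of_eventuallyEq hev

end LocalAction

/-! ### Invariance of the differential invariants -/

/-- The derivative of a vector field along another one, at a point. -/
def structVec (η : Fin (m + 1) → Pt m → Pt m) (z : Pt m) (i j : Fin (m + 1)) : Pt m :=
  fderiv ℝ (η j) z (η i z)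

lemma differentiableAt_along {X : Pt m → Pt m} {w : Pt m → ℝ} {z : Pt m} (hw : ContDiffAt ℝ 2 w z)
    (hX : DifferentiableAt ℝ X z) : DifferentiableAt ℝ (along X w) z :=
  (((hw.fderiv_right (m := 1) (by norm_num)).differentiableAt (by norm_num)).clm_apply hX :
    DifferentiableAt ℝ (fun y => fderiv ℝ w y (X y)) z)

lemma along_along {X Y : Pt m → Pt m} {w : Pt m → ℝ} {z : Pt m} (hw : ContDiffAt ℝ 2 w z)
    (hY : DifferentiableAt ℝ Y z) : along X (along Y w) z =
      fderiv ℝ (fderiv ℝ w) z (X z) (Y z) + fderiv ℝ w z (fderiv ℝ Y z (X z)) := by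
  change fderiv ℝ (fun y => fderiv ℝ w y (Y y)) z (X z) = _
  rw [fderiv_clm_apply
    ((hw.fderiv_right (m := 1) (by norm_num)).differentiableAt (by norm_num)) hY]
  simp [add_comm]

lemma I1_eq (η : Fin (m + 1) → Pt m → Pt m) (w : Pt m → ℝ) (z : Pt m) :
    I1 η w z = jetI1 (fun i => η i z) (fderiv ℝ w z) := rfl

lemma I2_eq {η : Fin (m + 1) → Pt m → Pt m} {w : Pt m → ℝ} {z : Pt m} (hw : ContDiffAt ℝ 2 w z)
    (hη : ∀ i, DifferentiableAt ℝ (η i) z) :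
    I2 η w z = jetI2 (fun i => η i z) (structVec η z) (fderiv ℝ w z)
      (fderiv ℝ (fderiv ℝ w) z) := by
  ext k
  have h2 : ∀ i j, w2 η w i j z = jetW2 (fun i => η i z) (structVec η z) (fderiv ℝ w z)
      (fderiv ℝ (fderiv ℝ w) z) i j := fun i j => by
    simp only [w2, jetW2, along_along hw (hη _)]
    rfl
  simp only [I2, jetI2, h2]
  rfl

lemma along_comp_act {A : LocalAction G Z} {X : Pt m → Pt m}
    (hX : ∀ {g z}, (g, z) ∈ A.dom → X (A.act g z) = fderiv ℝ (A.act g) z (X z))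
    {k : G} {z : Pt m} (h : (k, z) ∈ A.dom) {w : Pt m → ℝ}
    (hw : DifferentiableAt ℝ w (A.act k z)) :
    along X (fun y => w (A.act k y)) z = along X w (A.act k z) := by
  have h1 := hw.hasFDerivAt.comp z ((A.contDiffAt_act h).differentiableAt (by simp)).hasFDerivAt
  rw [along, along, hX h]
  exact DFunLike.congr_fun h1.fderiv _

lemma along_along_comp_act {A : LocalAction G Z} {X Y : Pt m → Pt m}
    (hX : ∀ {g z}, (g, z) ∈ A.dom → X (A.act g z) = fderiv ℝ (A.act g) z (X z))
    (hY : ∀ {g z}, (g, z) ∈ A.dom → Y (A.act g z) = fderiv ℝ (A.act g) z (Y z))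
    {k : G} {z : Pt m} (h : (k, z) ∈ A.dom) {w : Pt m → ℝ}
    (hw : ContDiffAt ℝ 2 w (A.act k z)) (hYd : DifferentiableAt ℝ Y (A.act k z)) :
    along X (along Y (fun y => w (A.act k y))) z = along X (along Y w) (A.act k z) := by
  rw [← along_comp_act hX h (differentiableAt_along hw hYd)]
  have : along Y (fun y => w (A.act k y)) =ᶠ[𝓝 z] fun y => along Y w (A.act k y) := by
    filter_upwards [A.eventually_dom h,
      (A.contDiffAt_act h).continuousAt.eventually (hw.eventually (by simp))] with y hy hy'
    exact along_comp_act hY hy (hy'.differentiableAt (by norm_num))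
  rw [along, along, this.fderiv_eq]

/-- Derivatives along fields preserved by the action commute with pullback by the action; the
invariants are built from such derivatives alone. -/
lemma I_comp_act {A : LocalAction G Z} {η : Fin (m + 1) → Pt m → Pt m}
    (hη : ∀ i {g z}, (g, z) ∈ A.dom → η i (A.act g z) = fderiv ℝ (A.act g) z (η i z))
    {k : G} {z : Pt m} (h : (k, z) ∈ A.dom) {w : Pt m → ℝ}
    (hw : ContDiffAt ℝ 2 w (A.act k z)) (hd : ∀ i, DifferentiableAt ℝ (η i) (A.act k z)) :
    (∀ i, w1 η (fun y => w (A.act k y)) i z = w1 η w i (A.act k z)) ∧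
    I1 η (fun y => w (A.act k y)) z = I1 η w (A.act k z) ∧
    I2 η (fun y => w (A.act k y)) z = I2 η w (A.act k z) := by
  have h1 : ∀ i, w1 η (fun y => w (A.act k y)) i z = w1 η w i (A.act k z) := fun i =>
    along_comp_act (hη i) h (hw.differentiableAt (by norm_num))
  have h2 : ∀ i j, w2 η (fun y => w (A.act k y)) i j z = w2 η w i j (A.act k z) := fun i j => by
    simp only [w2, along_along_comp_act (hη _) (hη _) h hw (hd _)]
  refine ⟨h1, ?_, ?_⟩
  · ext a; simp only [I1, h1]
  · ext k; simp only [I2, h1, h2]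

end

/-! ### Transport of solutions by symmetries. -/

section

variable {m : ℕ} {G : Type*} [Group G] [TopologicalSpace G]
  [ChartedSpace (EuclideanSpace ℝ (Fin (m + 1))) G] {Z : Set (Pt m)}

lemma IsSolution.mono {r : ℕ∞} {E : PDE2 m} {Ω Ω' : Set (Fin m → ℝ)} {u : (Fin m → ℝ) → ℝ}
    (h : IsSolution r Z E Ω u) (hΩ' : IsOpen Ω') (hs : Ω' ⊆ Ω) : IsSolution r Z E Ω' u where
  isOpen := hΩ'
  contDiffOn := h.contDiffOn.mono hs
  graph_subset := (Set.image_mono hs).trans h.graph_subset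
  eq_zero x hx := h.eq_zero x (hs hx)

/-- The image of a solution under a symmetry, near a point where it is a graph, is a solution. -/
lemma exists_image_solution {r : ℕ∞} (hr : 2 ≤ r) {E : PDE2 m} {A : LocalAction G Z}
    (hE : A.IsSymmetryGroup r E) {Ω : Set (Fin m → ℝ)} {u : (Fin m → ℝ) → ℝ}
    (hu : IsSolution r Z E Ω u) {x : Fin m → ℝ} (hx : x ∈ Ω) {g : G}
    (hg : (g, pt x (u x)) ∈ A.dom)
    (hn : pd (Fin.last m) (fun y => lastL m (A.act g⁻¹ y) - u (initL m (A.act g⁻¹ y)))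
      (A.act g (pt x (u x))) ≠ 0) :
    ∃ Ω' u', IsSolution r Z E Ω' u' ∧
      (∀ y ∈ Ω', lastL m (A.act g⁻¹ (pt y (u' y))) - u (initL m (A.act g⁻¹ (pt y (u' y)))) = 0) ∧
      ∃ y ∈ Ω', pt y (u' y) = A.act g (pt x (u x)) := by
  have hr1 : (1 : WithTop ℕ∞) ≤ (r : WithTop ℕ∞) := by
    have : (1 : ℕ∞) ≤ r := le_trans (by norm_num) hr
    exact_mod_cast this
  have hr0 : (r : WithTop ℕ∞) ≠ 0 := by intro h; simp [h] at hr1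
  have hrtop : (r : WithTop ℕ∞) ≤ ∞ := WithTop.coe_le_coe.mpr le_top
  have huc : ∀ y ∈ Ω, ContDiffAt ℝ r u y := fun y hy =>
    hu.contDiffOn.contDiffAt (hu.isOpen.mem_nhds hy)
  have hP : ContDiffOn ℝ r (fun y => pt y (u y)) Ω := fun y hy =>
    (contDiffAt_pt contDiffAt_id (huc y hy)).contDiffWithinAt
  obtain ⟨U, hU⟩ : ∃ U, U = Ω ∩ (fun y => pt y (u y)) ⁻¹' {z | (g, z) ∈ A.dom} := ⟨_, rfl⟩
  have hUo : IsOpen U := hU ▸ hP.continuousOn.isOpen_inter_preimage hu.isOpen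
    (A.isOpen_dom.preimage (Continuous.prodMk_right g))
  have hxU : x ∈ U := hU ▸ ⟨hx, hg⟩
  have hUΩ : ∀ y ∈ U, y ∈ Ω := fun y hy => (hU.subset hy).1
  have hUd : ∀ y ∈ U, (g, pt y (u y)) ∈ A.dom := fun y hy => (hU.subset hy).2
  have hC : ContDiffOn ℝ r (fun y => A.act g (pt y (u y))) U := fun y hy =>
    (ContDiffAt.comp (g := A.act g) (f := fun y => pt y (u y)) y
      ((A.contDiffAt_act (hUd y hy)).of_le hrtop)
      (contDiffAt_pt contDiffAt_id (huc y (hUΩ y hy)))).contDiffWithinAt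
  have hψ : ContDiffOn ℝ r (fun y => initL m (A.act g (pt y (u y)))) U :=
    (initL m).contDiff.comp_contDiffOn hC
  have hud : HasFDerivAt u (fderiv ℝ u x) x := ((huc x hx).differentiableAt hr0).hasFDerivAt
  have hPd : HasFDerivAt (fun y => pt y (u y))
      ((ptL m).comp ((ContinuousLinearMap.id ℝ _).prod (fderiv ℝ u x))) x :=
    (ptL m).hasFDerivAt.comp x ((hasFDerivAt_id x).prodMk hud)
  have hactd : HasFDerivAt (A.act g) (fderiv ℝ (A.act g) (pt x (u x))) (pt x (u x)) :=
    ((A.contDiffAt_act hg).differentiableAt (by simp)).hasFDerivAt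
  have hψd : HasFDerivAt (fun y => initL m (A.act g (pt y (u y))))
      ((initL m).comp ((fderiv ℝ (A.act g) (pt x (u x))).comp
        ((ptL m).comp ((ContinuousLinearMap.id ℝ _).prod (fderiv ℝ u x))))) x :=
    (initL m).hasFDerivAt.comp x
      (HasFDerivAt.comp (g := A.act g) (f := fun y => pt y (u y)) x hactd hPd)
  -- the derivative of the transformed defining function
  have hinvd : HasFDerivAt (A.act g⁻¹) (fderiv ℝ (A.act g⁻¹) (A.act g (pt x (u x))))
      (A.act g (pt x (u x))) :=
    ((A.contDiffAt_act (A.inv_mem hg)).differentiableAt (by simp)).hasFDerivAt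
  have hvd : HasFDerivAt (fun y => lastL m (A.act g⁻¹ y) - u (initL m (A.act g⁻¹ y)))
      ((lastL m).comp (fderiv ℝ (A.act g⁻¹) (A.act g (pt x (u x)))) -
        (fderiv ℝ u x).comp ((initL m).comp (fderiv ℝ (A.act g⁻¹) (A.act g (pt x (u x))))))
      (A.act g (pt x (u x))) := by
    refine ((lastL m).hasFDerivAt.comp _ hinvd).sub ?_
    refine HasFDerivAt.comp (g := u) (f := fun y => initL m (A.act g⁻¹ y)) _ ?_
      ((initL m).hasFDerivAt.comp _ hinvd)
    rw [A.inv_act hg, initL_pt]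
    exact hud
  obtain ⟨f', hf'⟩ := exists_equiv_of_injective rfl
    ((initL m).comp ((fderiv ℝ (A.act g) (pt x (u x))).comp
        ((ptL m).comp ((ContinuousLinearMap.id ℝ _).prod (fderiv ℝ u x)))))
    (fun h hh => by
      have h1 : initL m (fderiv ℝ (A.act g) (pt x (u x)) (pt h (fderiv ℝ u x h))) = 0 := hh
      have h2 := eq_smul_single_of_initL h1
      -- A vector in the kernel yields a vertical vector tangent to the transformed surface. The
      -- transformed defining function is constant on that surface but has nonzero vertical
      -- derivative, so this vector is zero. Hence the x-part of the transformed graph is a local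
      -- diffeomorphism in x.
      have h3 : fderiv ℝ (fun y => lastL m (A.act g⁻¹ y) - u (initL m (A.act g⁻¹ y)))
          (A.act g (pt x (u x)))
          (fderiv ℝ (A.act g) (pt x (u x)) (pt h (fderiv ℝ u x h))) = 0 := by
        rw [hvd.fderiv]
        simp [A.fderiv_act_inv hg]
      rw [h2, map_smul, smul_eq_mul] at h3
      have h4 := (mul_eq_zero.mp h3).resolve_right hn
      rw [h4, zero_smul] at h2
      have h5 := A.fderiv_act_inv hg (pt h (fderiv ℝ u x h))
      rw [h2, map_zero] at h5
      have h6 := congrArg (initL m) h5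
      simpa using h6.symm)
  obtain ⟨Φ, hxΦ, hΦU, hΦ, hΦs⟩ := exists_openPartialHomeomorph hr1 hUo hψ hxU f'
    (hψd.fderiv.trans hf')
  have key : ∀ y ∈ Φ.target, pt y (lastL m (A.act g (pt (Φ.symm y) (u (Φ.symm y))))) =
      A.act g (pt (Φ.symm y) (u (Φ.symm y))) := fun y hy => by
    have h1 := Φ.right_inv hy
    rw [hΦ] at h1
    have h4 := pt_initL_lastL (A.act g (pt (Φ.symm y) (u (Φ.symm y))))
    rwa [h1] at h4
  have hΦΩ : Φ.source ⊆ Ω := fun y hy => hUΩ y (hΦU hy)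
  have hsol := hu.mono Φ.open_source hΦΩ
  refine ⟨Φ.target, fun y => lastL m (A.act g (pt (Φ.symm y) (u (Φ.symm y)))),
    hE g Φ.source Φ.target u _ hsol ?_ ⟨Φ.open_target, ?_, ?_⟩ ?_, ?_, Φ x, Φ.map_source hxΦ, ?_⟩
  · rintro _ ⟨y, hy, rfl⟩
    exact hUd y (hΦU hy)
  · exact (lastL m).contDiff.comp_contDiffOn
      ((hC.mono hΦU).comp hΦs fun y hy => Φ.map_target hy)
  · rintro _ ⟨y, hy, rfl⟩
    simp only [key y hy]
    exact A.act_mem (hUd _ (hΦU (Φ.map_target hy)))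
  · ext z
    constructor
    · rintro ⟨_, ⟨y, hy, rfl⟩, rfl⟩
      refine ⟨Φ y, Φ.map_source hy, ?_⟩
      simpa only [Φ.left_inv hy] using key _ (Φ.map_source hy)
    · rintro ⟨y, hy, rfl⟩
      exact ⟨_, ⟨Φ.symm y, Φ.map_target hy, rfl⟩, (key y hy).symm⟩
  · intro y hy
    simp only [key y hy, A.inv_act (hUd _ (hΦU (Φ.map_target hy)))]
    simp
  · simpa only [Φ.left_inv hxΦ] using key _ (Φ.map_source hxΦ)

/-- If a generic `2`-jet of a function with the same invariants as `w` comes from a solution, then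
the jet of `w` satisfies the equation. -/
lemma covariant_eq_zero_of_solution {r : ℕ∞} (hr : 2 ≤ r) {E : PDE2 m} {A : LocalAction G Z}
    (hA : A.IsSimplyTransitive) (hE : A.IsSymmetryGroup r E)
    {η : Fin (m + 1) → Pt m → Pt m}
    (hηb : ∀ z ∈ Z, ∃ b : Module.Basis (Fin (m + 1)) ℝ (Pt m), ∀ i, b i = η i z)
    (hηd : ∀ i, ∀ z ∈ Z, DifferentiableAt ℝ (η i) z)
    (hη : ∀ i {g z}, (g, z) ∈ A.dom → η i (A.act g z) = fderiv ℝ (A.act g) z (η i z))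
    {Ω : Set (Fin m → ℝ)} {u : (Fin m → ℝ) → ℝ}
    (hu : IsSolution r Z E Ω u) {x : Fin m → ℝ} (hx : x ∈ Ω) {w' : Pt m → ℝ}
    (hw' : ContDiffAt ℝ 2 w' (pt x (u x))) (hgen' : IsGeneric η w' (pt x (u x)))
    (hgrad : grad u x = implicitGrad w' (pt x (u x)))
    (hhess : hess u x = implicitHess w' (pt x (u x)))
    {z : Pt m} (hz : z ∈ Z) {w : Pt m → ℝ} (hw : ContDiffAt ℝ 2 w z) (hgen : IsGeneric η w z)
    (hI1 : I1 η w z = I1 η w' (pt x (u x))) (hI2 : I2 η w z = I2 η w' (pt x (u x))) :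
    covariant E w z = 0 := by
  have hr2 : (2 : WithTop ℕ∞) ≤ (r : WithTop ℕ∞) := WithTop.coe_le_coe.mpr hr
  have hz' : pt x (u x) ∈ Z := hu.graph_subset ⟨x, hx, rfl⟩
  have huc : ContDiffAt ℝ 2 u x :=
    (hu.contDiffOn.contDiffAt (hu.isOpen.mem_nhds hx)).of_le hr2
  -- `w'` shares only a 2-jet with the solution and need not vanish on its graph. The function u -
  -- u(x) does, so its pullback vanishes on the transformed graph.
  obtain ⟨w₀, hw₀⟩ : ∃ w₀ : Pt m → ℝ, w₀ = fun y => lastL m y - u (initL m y) := ⟨_, rfl⟩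
  have hw₀c : ContDiffAt ℝ 2 w₀ (pt x (u x)) := by
    rw [hw₀]
    refine (lastL m).contDiff.contDiffAt.sub
      (ContDiffAt.comp (g := u) (f := initL m) _ ?_ (initL m).contDiff.contDiffAt)
    rwa [initL_pt]
  have hw₀n : pd (Fin.last m) w₀ (pt x (u x)) ≠ 0 := by
    have h1 : HasFDerivAt w₀ (lastL m - (fderiv ℝ u x).comp (initL m)) (pt x (u x)) := by
      rw [hw₀]
      refine (lastL m).hasFDerivAt.sub
        (HasFDerivAt.comp (g := u) (f := initL m) _ ?_ (initL m).hasFDerivAt)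
      rw [initL_pt]
      exact (huc.differentiableAt (by norm_num)).hasFDerivAt
    have h2 : initL m (Pi.single (Fin.last m) 1) = 0 := by
      ext a
      simp [initL, (Fin.castSucc_lt_last a).ne]
    rw [pd, h1.fderiv]
    simp [h2, lastL]
  have hw₀z : ∀ y, w₀ (pt y (u y)) = 0 := fun y => by rw [hw₀]; simp
  have hg₀ := grad_eq_implicitGrad (huc.differentiableAt (by norm_num))
    (hw₀c.differentiableAt (by norm_num)) (Eventually.of_forall hw₀z) hw₀n
  have hh₀ := hess_eq_implicitHess huc hw₀c (Eventually.of_forall hw₀z) hw₀n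
  have hc₀ : Contact (fderiv ℝ w' (pt x (u x))) (fderiv ℝ (fderiv ℝ w') (pt x (u x)))
      (fderiv ℝ w₀ (pt x (u x))) (fderiv ℝ (fderiv ℝ w₀) (pt x (u x))) := by
    refine contact_of_implicit_eq (symm_snd hw') (symm_snd hw₀c) hgen'.pd_last_ne hw₀n ?_ ?_
    · rw [← implicitGrad_eq, ← implicitGrad_eq, ← hgrad, ← hg₀]
    · rw [← implicitHess_eq hw', ← implicitHess_eq hw₀c, ← hhess, ← hh₀]
  have hI₀ := hc₀.jetI_eq (fun i => η i (pt x (u x))) (structVec η (pt x (u x)))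
    (symm_snd hw') (symm_snd hw₀c)
  rw [← I1_eq, ← I1_eq, ← I2_eq hw' fun i => hηd i _ hz', ← I2_eq hw₀c fun i => hηd i _ hz'] at hI₀
  have hl₀ : w1 η w₀ (Fin.last m) (pt x (u x)) ≠ 0 := by
    obtain ⟨l, hl, h1, -⟩ := hc₀
    rw [w1, along, h1]
    exact mul_ne_zero hl hgen'.last_ne
  obtain ⟨g, ⟨hg, hgz⟩, -⟩ := hA.existsUnique _ hz' z hz
  have hk : (g⁻¹, z) ∈ A.dom := hgz ▸ A.inv_mem hg
  have hkz : A.act g⁻¹ z = pt x (u x) := by rw [← hgz, A.inv_act hg]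
  obtain ⟨v, hv⟩ : ∃ v : Pt m → ℝ, v = fun y => w₀ (A.act g⁻¹ y) := ⟨_, rfl⟩
  have hw₀k : ContDiffAt ℝ 2 w₀ (A.act g⁻¹ z) := by rwa [hkz]
  have hvc : ContDiffAt ℝ 2 v z := hv ▸ ContDiffAt.comp (g := w₀) (f := A.act g⁻¹) z hw₀k
    ((A.contDiffAt_act hk).of_le two_le_smooth)
  obtain ⟨hv1, hvI1, hvI2⟩ := I_comp_act hη hk hw₀k fun i => hηd i _ (hkz ▸ hz')
  rw [← hv, hkz] at hvI1 hvI2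
  have hvl : w1 η v (Fin.last m) z ≠ 0 := by rwa [hv, hv1, hkz]
  obtain ⟨b, hb⟩ := hηb z hz
  have hbη : (fun i => η i z) = b := funext fun i => (hb i).symm
  have hc : Contact (fderiv ℝ w z) (fderiv ℝ (fderiv ℝ w) z) (fderiv ℝ v z)
      (fderiv ℝ (fderiv ℝ v) z) := by
    refine contact_of_jetI_eq b (structVec η z) (symm_snd hw) (symm_snd hvc) ?_ ?_ ?_ ?_ ?_
    · rw [hb]; exact hgen.last_ne
    · rw [hb]; exact hvl
    · intro a a' h
      rw [hb, hb]; exact hgen.mul_ne a a' h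
    · rw [← hbη, ← I1_eq, ← I1_eq, hI1, hvI1, hI₀.1]
    · rw [← hbη, ← I2_eq hw fun i => hηd i z hz, ← I2_eq hvc fun i => hηd i z hz, hI2, hvI2, hI₀.2]
  -- The transformed surface is transversal to the u-direction because it has contact with the level
  -- surface of `w`, for which w_n ≠ 0. This makes it a graph near `z`.
  have hvn : pd (Fin.last m) v z ≠ 0 := by
    obtain ⟨l, hl, h1, -⟩ := hc
    rw [pd, h1]
    exact mul_ne_zero hl hgen.pd_last_ne
  obtain ⟨hG, hH⟩ := hc.implicit_eq (symm_snd hw) (symm_snd hvc) hgen.pd_last_ne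
  obtain ⟨Ω', u', hu', h0, y, hy, hyz⟩ := exists_image_solution hr hE hu hx hg (by
    rw [hgz]
    rw [hv, hw₀] at hvn
    exact hvn)
  rw [hgz] at hyz
  have hu'c : ContDiffAt ℝ 2 u' y :=
    (hu'.contDiffOn.contDiffAt (hu'.isOpen.mem_nhds hy)).of_le hr2
  have h0' : ∀ᶠ y' in 𝓝 y, v (pt y' (u' y')) = 0 := by
    filter_upwards [hu'.isOpen.mem_nhds hy] with y' hy'
    rw [hv, hw₀]
    exact h0 y' hy'
  rw [← hyz] at hvc hvn
  have hgv := grad_eq_implicitGrad (hu'c.differentiableAt (by norm_num))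
    (hvc.differentiableAt (by norm_num)) h0' hvn
  have hhv := hess_eq_implicitHess hu'c hvc h0' hvn
  have := hu'.eq_zero y hy
  rw [hgv, hhv, implicitGrad_eq, implicitHess_eq hvc, hyz, hG, hH] at this
  rw [covariant, implicitGrad_eq, implicitHess_eq hw, this]

end

/-! ### A continuous family of jets realising given invariants; openness of the violating set. -/

section

variable {m : ℕ}

/-! ### Jets with prescribed invariants -/

/-- The values `p(η_i)` for the invariants `κ`, normalized by `p(η_n) = 1`. -/
def coeff1 (κ : (Fin m → ℝ) × (Pairs m → ℝ)) (i : Fin (m + 1)) : ℝ :=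
  Fin.snoc (α := fun _ => ℝ) κ.1 1 i

/-- The values of `w_(ii)` for the invariants `κ`, normalized by `w_(nn) = 0`. -/
def coeffDiag (κ : (Fin m → ℝ) × (Pairs m → ℝ)) (i : Fin (m + 1)) : ℝ :=
  if h : i < Fin.last m then κ.2 ⟨(i, Fin.last m), h⟩ else 0

/-- The values of `w_(ij)`, `i < j`, for the invariants `κ`, normalized by `w_(in) = 0`. -/
def coeffOff (κ : (Fin m → ℝ) × (Pairs m → ℝ)) (i j : Fin (m + 1)) : ℝ :=
  if h : i < j then
    if j = Fin.last m then 0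
    else (coeff1 κ i ^ 2 * coeffDiag κ j + coeff1 κ j ^ 2 * coeffDiag κ i - κ.2 ⟨(i, j), h⟩) /
      (2 * (coeff1 κ i * coeff1 κ j))
  else 0

/-- The values of `w_(ij)` for the invariants `κ`. -/
def coeff2 (κ : (Fin m → ℝ) × (Pairs m → ℝ)) (i j : Fin (m + 1)) : ℝ :=
  if i = j then coeffDiag κ i else coeffOff κ i j + coeffOff κ j i

/-- First derivative of a function with the invariants `κ`. -/
def jetP (b : Module.Basis (Fin (m + 1)) ℝ (Pt m)) (κ : (Fin m → ℝ) × (Pairs m → ℝ)) :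
    Pt m →L[ℝ] ℝ :=
  ∑ i, coeff1 κ i • LinearMap.toContinuousLinearMap (b.coord i)

/-- Second derivative of a function with the invariants `κ`. -/
def jetQ (b : Module.Basis (Fin (m + 1)) ℝ (Pt m)) (c : Fin (m + 1) → Fin (m + 1) → Pt m)
    (κ : (Fin m → ℝ) × (Pairs m → ℝ)) : Pt m →L[ℝ] Pt m →L[ℝ] ℝ :=
  ∑ i, ∑ j, (coeff2 κ i j - (jetP b κ (c i j) + jetP b κ (c j i)) / 2) •
    (LinearMap.toContinuousLinearMap (b.coord i)).smulRight
      (LinearMap.toContinuousLinearMap (b.coord j))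

lemma coeff2_symm (κ : (Fin m → ℝ) × (Pairs m → ℝ)) (i j : Fin (m + 1)) :
    coeff2 κ i j = coeff2 κ j i := by
  by_cases h : i = j
  · rw [h]
  · simp only [coeff2, h, Ne.symm h, if_false]
    ring

lemma jetP_apply (b : Module.Basis (Fin (m + 1)) ℝ (Pt m)) (κ : (Fin m → ℝ) × (Pairs m → ℝ))
    (v : Pt m) : jetP b κ v = ∑ i, coeff1 κ i * b.repr v i := by
  simp [jetP, sum_apply]

lemma jetQ_apply (b : Module.Basis (Fin (m + 1)) ℝ (Pt m))
    (c : Fin (m + 1) → Fin (m + 1) → Pt m) (κ : (Fin m → ℝ) × (Pairs m → ℝ)) (u v : Pt m) :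
    jetQ b c κ u v = ∑ i, ∑ j, (coeff2 κ i j - (jetP b κ (c i j) + jetP b κ (c j i)) / 2) *
      (b.repr u i * b.repr v j) := by
  simp [jetQ, sum_apply]

lemma jetP_basis (b : Module.Basis (Fin (m + 1)) ℝ (Pt m)) (κ : (Fin m → ℝ) × (Pairs m → ℝ))
    (i : Fin (m + 1)) : jetP b κ (b i) = coeff1 κ i := by
  simp [jetP_apply, Finsupp.single_apply]

lemma jetQ_basis (b : Module.Basis (Fin (m + 1)) ℝ (Pt m))
    (c : Fin (m + 1) → Fin (m + 1) → Pt m) (κ : (Fin m → ℝ) × (Pairs m → ℝ))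
    (i j : Fin (m + 1)) :
    jetQ b c κ (b i) (b j) = coeff2 κ i j - (jetP b κ (c i j) + jetP b κ (c j i)) / 2 := by
  simp [jetQ_apply, Finsupp.single_apply]

lemma jetQ_symm (b : Module.Basis (Fin (m + 1)) ℝ (Pt m))
    (c : Fin (m + 1) → Fin (m + 1) → Pt m) (κ : (Fin m → ℝ) × (Pairs m → ℝ)) (u v : Pt m) :
    jetQ b c κ u v = jetQ b c κ v u := by
  rw [jetQ_apply, jetQ_apply, Finset.sum_comm]
  refine Finset.sum_congr rfl fun i _ => Finset.sum_congr rfl fun j _ => ?_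
  rw [coeff2_symm κ j i]
  ring

lemma jetI1_jetP (b : Module.Basis (Fin (m + 1)) ℝ (Pt m)) (κ : (Fin m → ℝ) × (Pairs m → ℝ)) :
    jetI1 b (jetP b κ) = κ.1 := by
  ext a
  simp [jetI1, jetP_basis, coeff1]

/-- With the normalization w_(n) = 1, w_(nn) = w_(an) = 0, the invariant I_(an) is just w_(aa), and
I_(ab) is affine in w_(ab) with coefficient -2 I_(a) I_(b), so it can be solved for w_(ab). -/
lemma jetI2_jetP (b : Module.Basis (Fin (m + 1)) ℝ (Pt m))
    (c : Fin (m + 1) → Fin (m + 1) → Pt m) (κ : (Fin m → ℝ) × (Pairs m → ℝ))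
    (hκ : ∀ a a' : Fin m, a < a' → κ.1 a * κ.1 a' ≠ 0) :
    jetI2 b c (jetP b κ) (jetQ b c κ) = κ.2 := by
  -- The correction subtracted in `jetQ` cancels the first-order terms that the derivatives of the
  -- frame contribute to w_(ij).
  have hW : ∀ i j, jetW2 b c (jetP b κ) (jetQ b c κ) i j = coeff2 κ i j := fun i j => by
    simp only [jetW2, jetQ_basis]
    rw [coeff2_symm κ j i]
    ring
  have hlast : coeff1 κ (Fin.last m) = 1 := by simp [coeff1]
  ext ⟨⟨i, j⟩, hij⟩
  simp only at hij
  simp only [jetI2, hW, jetP_basis, hlast, one_pow, div_one]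
  simp only [coeff2, if_true, hij.ne, if_false]
  have h0 : coeffOff κ j i = 0 := by simp [coeffOff, hij.not_gt]
  rw [h0, add_zero]
  revert hij
  refine Fin.lastCases (fun hij => ?_) (fun a' hij => ?_) j
  · simp [coeffOff, coeffDiag, hlast, hij]
  · have hi : i < Fin.last m := hij.trans (Fin.castSucc_lt_last a')
    obtain ⟨a, rfl⟩ : ∃ a : Fin m, i = a.castSucc := ⟨i.castPred hi.ne, by simp⟩
    have hne : coeff1 κ a.castSucc * coeff1 κ a'.castSucc ≠ 0 := by
      simpa [coeff1] using hκ a a' (Fin.castSucc_lt_castSucc_iff.mp hij)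
    simp only [coeffOff, hij, dif_pos, (Fin.castSucc_lt_last a').ne, if_false]
    have h1 := left_ne_zero_of_mul hne
    have h2 := right_ne_zero_of_mul hne
    field_simp
    ring

lemma continuous_coeff1 (i : Fin (m + 1)) :
    Continuous fun κ : (Fin m → ℝ) × (Pairs m → ℝ) => coeff1 κ i := by
  refine Fin.lastCases ?_ (fun a => ?_) i
  · simpa [coeff1] using continuous_const
  · simp only [coeff1, Fin.snoc_castSucc]
    fun_prop

lemma continuous_coeffDiag (i : Fin (m + 1)) :
    Continuous fun κ : (Fin m → ℝ) × (Pairs m → ℝ) => coeffDiag κ i := by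
  by_cases h : i < Fin.last m
  · simp only [coeffDiag, h, dif_pos]
    fun_prop
  · simpa [coeffDiag, h] using continuous_const

lemma continuousAt_coeffOff {κ : (Fin m → ℝ) × (Pairs m → ℝ)}
    (hκ : ∀ a a' : Fin m, a < a' → κ.1 a * κ.1 a' ≠ 0) (i j : Fin (m + 1)) :
    ContinuousAt (fun κ => coeffOff κ i j) κ := by
  by_cases hij : i < j
  swap
  · simpa [coeffOff, hij] using continuousAt_const
  by_cases hj : j = Fin.last m
  · simpa [coeffOff, hij, hj] using continuousAt_const
  have hi : i ≠ Fin.last m := (hij.trans_le (Fin.le_last j)).ne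
  obtain ⟨a, rfl⟩ : ∃ a : Fin m, i = a.castSucc := ⟨i.castPred hi, by simp⟩
  obtain ⟨a', rfl⟩ : ∃ a : Fin m, j = a.castSucc := ⟨j.castPred hj, by simp⟩
  have hne : coeff1 κ a.castSucc * coeff1 κ a'.castSucc ≠ 0 := by
    simpa [coeff1] using hκ a a' (Fin.castSucc_lt_castSucc_iff.mp hij)
  simp only [coeffOff, hij, dif_pos, hj, if_false]
  have h1 := continuous_coeff1 (m := m) a.castSucc
  have h2 := continuous_coeff1 (m := m) a'.castSucc
  have h3 := continuous_coeffDiag (m := m) a.castSucc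
  have h4 := continuous_coeffDiag (m := m) a'.castSucc
  refine ContinuousAt.div ?_ ?_ (mul_ne_zero two_ne_zero hne)
  · exact Continuous.continuousAt (by fun_prop)
  · exact Continuous.continuousAt (by fun_prop)

lemma continuous_jetP (b : Module.Basis (Fin (m + 1)) ℝ (Pt m)) (v : Pt m) :
    Continuous fun κ => jetP b κ v := by
  simp only [jetP_apply]
  exact continuous_finsetSum _ fun i _ => (continuous_coeff1 i).mul continuous_const

lemma continuousAt_jetQ (b : Module.Basis (Fin (m + 1)) ℝ (Pt m))
    (c : Fin (m + 1) → Fin (m + 1) → Pt m) {κ : (Fin m → ℝ) × (Pairs m → ℝ)}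
    (hκ : ∀ a a' : Fin m, a < a' → κ.1 a * κ.1 a' ≠ 0) (u v : Pt m) :
    ContinuousAt (fun κ => jetQ b c κ u v) κ := by
  simp only [jetQ_apply]
  refine tendsto_finsetSum _ fun i _ => tendsto_finsetSum _ fun j _ => ?_
  refine Tendsto.mul (Tendsto.sub ?_ ?_) tendsto_const_nhds
  · by_cases h : i = j
    · simp only [coeff2, h, if_true]
      exact (continuous_coeffDiag j).continuousAt
    · simp only [coeff2, h, if_false]
      exact (continuousAt_coeffOff hκ i j).add (continuousAt_coeffOff hκ j i)
  · exact (((continuous_jetP b _).add (continuous_jetP b _)).div_const 2).continuousAt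

/-- Every jet is the jet of a quadratic polynomial. -/
lemma exists_function_of_jet (p : Pt m →L[ℝ] ℝ) (q : Pt m →L[ℝ] Pt m →L[ℝ] ℝ)
    (hq : ∀ s t, q s t = q t s) (z : Pt m) :
    ∃ w : Pt m → ℝ, ContDiff ℝ 2 w ∧ fderiv ℝ w z = p ∧ fderiv ℝ (fderiv ℝ w) z = q := by
  have hd : ∀ y, HasFDerivAt (fun y => p y + (1 / 2) * q (y - z) (y - z)) (p + q (y - z)) y := by
    intro y
    have h1 : HasFDerivAt (fun y : Pt m => y - z) (ContinuousLinearMap.id ℝ (Pt m)) y :=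
      (hasFDerivAt_id y).sub_const z
    have h2 : HasFDerivAt (fun y => q (y - z)) q y := q.hasFDerivAt.comp y h1
    have h3 := p.hasFDerivAt (x := y) |>.add ((h2.clm_apply h1).const_mul (1 / 2 : ℝ))
    convert! h3 using 1
    ext v
    have h4 := hq v (y - z)
    simp only [map_sub, sub_apply] at h4
    simp [h4]
    ring
  have hf : fderiv ℝ (fun y => p y + (1 / 2) * q (y - z) (y - z)) = fun y => p + q (y - z) :=
    funext fun y => (hd y).fderiv
  refine ⟨fun y => p y + (1 / 2) * q (y - z) (y - z), by fun_prop, ?_, ?_⟩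
  · rw [hf]; simp
  · rw [hf]
    have h2 : HasFDerivAt (fun y => p + q (y - z)) q z :=
      (HasFDerivAt.comp (g := q) (f := fun y => y - z) z q.hasFDerivAt
        ((hasFDerivAt_id z).sub_const z)).const_add p
    exact h2.fderiv

/-- The invariants of the generic jets that violate the equation. -/
def violating (η : Fin (m + 1) → Pt m → Pt m) (Z : Set (Pt m)) (E : PDE2 m) :
    Set ((Fin m → ℝ) × (Pairs m → ℝ)) :=
  {κ | ∃ z ∈ Z, ∃ w : Pt m → ℝ, ContDiffAt ℝ 2 w z ∧ IsGeneric η w z ∧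
    I1 η w z = κ.1 ∧ I2 η w z = κ.2 ∧ covariant E w z ≠ 0}

/-- The point `z` of a violating jet is kept fixed while the invariants vary. The normalized jets
`jetP`, `jetQ` depend continuously on them, and at the given values they have contact with the
violating jet, so E ≠ 0 there and, by continuity, nearby. -/
lemma isOpen_violating {η : Fin (m + 1) → Pt m → Pt m} {Z : Set (Pt m)} {E : PDE2 m}
    (hηb : ∀ z ∈ Z, ∃ b : Module.Basis (Fin (m + 1)) ℝ (Pt m), ∀ i, b i = η i z)
    (hηd : ∀ i, ∀ z ∈ Z, DifferentiableAt ℝ (η i) z)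
    (hE : ContinuousOn
      (fun j : Pt m × (Fin m → ℝ) × Matrix (Fin m) (Fin m) ℝ => E j.1 j.2.1 j.2.2)
      {j | j.1 ∈ Z ∧ j.2.2.IsSymm}) : IsOpen (violating η Z E) := by
  rw [isOpen_iff_mem_nhds]
  rintro κ ⟨z, hz, w, hw, hgen, hI1, hI2, hne⟩
  obtain ⟨b, hb⟩ := hηb z hz
  have hbη : (fun i => η i z) = b := funext fun i => (hb i).symm
  have hκ : ∀ a a' : Fin m, a < a' → κ.1 a * κ.1 a' ≠ 0 := fun a a' h => by
    rw [← hI1]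
    have := hgen.mul_ne a a' h
    exact mul_ne_zero (div_ne_zero (left_ne_zero_of_mul this) hgen.last_ne)
      (div_ne_zero (right_ne_zero_of_mul this) hgen.last_ne)
  obtain ⟨c, hc⟩ : ∃ c, c = structVec η z := ⟨_, rfl⟩
  have hcontact : Contact (fderiv ℝ w z) (fderiv ℝ (fderiv ℝ w) z) (jetP b κ) (jetQ b c κ) := by
    refine contact_of_jetI_eq b c (symm_snd hw) (jetQ_symm b c κ) ?_ ?_ ?_ ?_ ?_
    · rw [hb]; exact hgen.last_ne
    · simp [jetP_basis, coeff1]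
    · intro a a' h
      rw [hb, hb]; exact hgen.mul_ne a a' h
    · rw [jetI1_jetP, ← hbη, ← I1_eq, hI1]
    · rw [jetI2_jetP b c κ hκ, ← hbη, hc, ← I2_eq hw fun i => hηd i z hz, hI2]
  obtain ⟨hG, hH⟩ := hcontact.implicit_eq (symm_snd hw) (jetQ_symm b c κ) hgen.pd_last_ne
  have hpn : jetP b κ (Pi.single (Fin.last m) 1) ≠ 0 := by
    obtain ⟨l, hl, h1, -⟩ := hcontact
    rw [h1]
    exact mul_ne_zero hl hgen.pd_last_ne
  have hcG : ContinuousAt (fun κ => jetGrad (jetP b κ)) κ := by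
    rw [continuousAt_pi]
    intro a
    exact (continuous_jetP b _).continuousAt.neg.div (continuous_jetP b _).continuousAt hpn
  have hcH : ContinuousAt (fun κ => jetHess (jetP b κ) (jetQ b c κ)) κ := by
    refine continuousAt_pi.mpr fun a => continuousAt_pi.mpr fun a' => ?_
    simp only [jetHess, Matrix.of_apply]
    have hp := fun v => (continuous_jetP b v).continuousAt (x := κ)
    have hq := fun u v => continuousAt_jetQ b c hκ u v
    exact ((((hq _ _).div (hp _) hpn).neg.add (((hq _ _).mul (hp _)).div ((hp _).pow 2)
      (pow_ne_zero 2 hpn))).add (((hq _ _).mul (hp _)).div ((hp _).pow 2)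
      (pow_ne_zero 2 hpn))).sub ((((hp _).mul (hp _)).mul (hq _ _)).div ((hp _).pow 3)
      (pow_ne_zero 3 hpn))
  have hcE : ContinuousAt (fun κ => E z (jetGrad (jetP b κ)) (jetHess (jetP b κ) (jetQ b c κ)))
      κ := by
    -- Continuity of `E` is available only on symmetric matrices, so the whole family of Hessians
    -- has to be symmetric.
    have h1 := hE (z, jetGrad (jetP b κ), jetHess (jetP b κ) (jetQ b c κ))
      ⟨hz, jetHess_isSymm _ _ (jetQ_symm b c κ)⟩
    refine h1.tendsto.comp (tendsto_nhdsWithin_iff.mpr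
      ⟨(continuousAt_const.prodMk (hcG.prodMk hcH)).tendsto, Eventually.of_forall fun κ' =>
        ⟨hz, jetHess_isSymm _ _ (jetQ_symm b c κ')⟩⟩)
  have hEne : E z (jetGrad (jetP b κ)) (jetHess (jetP b κ) (jetQ b c κ)) ≠ 0 := by
    rwa [hG, hH, ← implicitGrad_eq, ← implicitHess_eq hw]
  have hev : ∀ᶠ κ' in 𝓝 κ, ∀ a a' : Fin m, a < a' → κ'.1 a * κ'.1 a' ≠ 0 := by
    refine eventually_all.mpr fun a => eventually_all.mpr fun a' => ?_
    by_cases h : a < a'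
    · have hcont : Continuous fun κ' : (Fin m → ℝ) × (Pairs m → ℝ) => κ'.1 a * κ'.1 a' := by
        fun_prop
      exact (hcont.continuousAt.eventually_ne (hκ a a' h)).mono fun _ h' _ => h'
    · exact Eventually.of_forall fun _ h' => absurd h' h
  filter_upwards [hcE.eventually_ne hEne, hev,
    (continuous_jetP b (Pi.single (Fin.last m) 1)).continuousAt.eventually_ne hpn]
    with κ' h1 h2 h3
  -- The value of the function at `z` is irrelevant: `violating` does not ask it to vanish.
  obtain ⟨w', hw', hp', hq'⟩ := exists_function_of_jet (jetP b κ') (jetQ b c κ')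
    (jetQ_symm b c κ') z
  have hw1 : ∀ i, w1 η w' i z = coeff1 κ' i := fun i => by
    rw [w1, along, hp', ← hb, jetP_basis]
  refine ⟨z, hz, w', hw'.contDiffAt, ⟨?_, ?_, ?_⟩, ?_, ?_, ?_⟩
  · rwa [pd, hp']
  · simp [hw1, coeff1]
  · intro a a' h
    simpa [hw1, coeff1] using h2 a a' h
  · rw [I1_eq, hp', hbη, jetI1_jetP]
  · rw [I2_eq hw'.contDiffAt fun i => hηd i z hz, hp', hq', hbη, ← hc, jetI2_jetP b c κ' h2]
  · rwa [covariant, implicitGrad_eq, implicitHess_eq hw'.contDiffAt, hp', hq']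

end

end CovariantPDE

end

/-! ### The main theorem. -/

theorem theorem4 {m : ℕ} {G : Type*} [Group G] [TopologicalSpace G]
    [ChartedSpace (EuclideanSpace ℝ (Fin (m + 1))) G] [LieGroup (𝓡 (m + 1)) ∞ G]
    (r : ℕ∞) (hr : 2 ≤ r)
    (Z : Set (CovariantPDE.Pt m)) (hZ : IsOpen Z)
    (E : CovariantPDE.PDE2 m)
    (A : CovariantPDE.LocalAction G Z) (hA : A.IsSimplyTransitive)
    (hE : A.IsSymmetryGroup r E)
    (z₀ : CovariantPDE.Pt m) (hz₀ : z₀ ∈ Z)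
    (e : Module.Basis (Fin (m + 1)) ℝ (CovariantPDE.Pt m))
    (η : Fin (m + 1) → CovariantPDE.Pt m → CovariantPDE.Pt m)
    (hη : ∀ i, η i = A.rightInvariant z₀ (e i)) :
    ∃ F : (Fin m → ℝ) × (CovariantPDE.Pairs m → ℝ) → ℝ,
      -- if `E` is continuous, then `F` is smooth
      (ContinuousOn
          (fun j : CovariantPDE.Pt m × (Fin m → ℝ) × Matrix (Fin m) (Fin m) ℝ =>
            E j.1 j.2.1 j.2.2) {j | j.1 ∈ Z ∧ j.2.2.IsSymm} →
        ContDiff ℝ ∞ F) ∧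
      -- `w = 0` is a solution surface if and only if `F(I_(i), I_(ij)) = 0` on `w = 0`
      (∀ (V : Set (CovariantPDE.Pt m)) (w : CovariantPDE.Pt m → ℝ),
        IsOpen V → V ⊆ Z → ContDiffOn ℝ r w V →
        (∀ z ∈ V, w z = 0 → CovariantPDE.IsGeneric η w z) →
        ((CovariantPDE.SurfaceIsSolution r Z E V w ↔
            ∀ z ∈ V, w z = 0 → CovariantPDE.covariant E w z = 0) ∧
         ((∀ z ∈ V, w z = 0 → CovariantPDE.covariant E w z = 0) ↔
            ∀ z ∈ V, w z = 0 → F (CovariantPDE.I1 η w z, CovariantPDE.I2 η w z) = 0))) ∧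
      -- the covariant form and `F = 0` agree pointwise, unless `E = 0` has jets without solutions
      (CovariantPDE.LocallySolvable r Z E →
        ∀ z ∈ Z, ∀ w : CovariantPDE.Pt m → ℝ, ContDiffAt ℝ r w z → w z = 0 →
          CovariantPDE.IsGeneric η w z →
          (CovariantPDE.covariant E w z = 0 ↔
            F (CovariantPDE.I1 η w z, CovariantPDE.I2 η w z) = 0)) := by

  have hr2 : (2 : WithTop ℕ∞) ≤ (r : WithTop ℕ∞) := WithTop.coe_le_coe.mpr hr
  have hηb : ∀ z ∈ Z, ∃ b : Module.Basis (Fin (m + 1)) ℝ (CovariantPDE.Pt m),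
      ∀ i, b i = η i z := fun z hz => by
    simpa only [hη] using hA.exists_basis hz₀ e hz
  have hηd : ∀ i, ∀ z ∈ Z, DifferentiableAt ℝ (η i) z := fun i z hz => by
    rw [hη]
    exact hA.differentiableAt_rightInvariant hz₀ _ hz
  have hηact : ∀ i {g z}, (g, z) ∈ A.dom →
      η i (A.act g z) = fderiv ℝ (A.act g) z (η i z) := fun i {g z} h => by
    rw [hη]
    exact hA.rightInvariant_act hz₀ _ h
  -- a jet of a solution, and the generic jets with the same invariants
  have key : ∀ {Ω u}, CovariantPDE.IsSolution r Z E Ω u → ∀ {x}, x ∈ Ω → ∀ {w},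
      ContDiffAt ℝ 2 w (CovariantPDE.pt x (u x)) →
      CovariantPDE.IsGeneric η w (CovariantPDE.pt x (u x)) →
      CovariantPDE.grad u x = CovariantPDE.implicitGrad w (CovariantPDE.pt x (u x)) →
      CovariantPDE.hess u x = CovariantPDE.implicitHess w (CovariantPDE.pt x (u x)) →
      (CovariantPDE.I1 η w (CovariantPDE.pt x (u x)),
        CovariantPDE.I2 η w (CovariantPDE.pt x (u x))) ∉ CovariantPDE.violating η Z E := by
    rintro Ω u hu x hx w hw hgen hg hh ⟨z', hz', w', hw', hgen', hI1, hI2, hne⟩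
    exact hne (CovariantPDE.covariant_eq_zero_of_solution hr hA hE hηb hηd hηact hu hx hw hgen
      hg hh hz' hw' hgen' hI1 hI2)
  -- Only the zero set of F matters. Values attained by no generic jet fall into it, which is
  -- harmless.
  have hF : ∃ F : (Fin m → ℝ) × (CovariantPDE.Pairs m → ℝ) → ℝ,
      (ContinuousOn
          (fun j : CovariantPDE.Pt m × (Fin m → ℝ) × Matrix (Fin m) (Fin m) ℝ =>
            E j.1 j.2.1 j.2.2) {j | j.1 ∈ Z ∧ j.2.2.IsSymm} → ContDiff ℝ ∞ F) ∧
      ∀ κ, F κ = 0 ↔ κ ∉ CovariantPDE.violating η Z E := by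
    by_cases hc : ContinuousOn
        (fun j : CovariantPDE.Pt m × (Fin m → ℝ) × Matrix (Fin m) (Fin m) ℝ =>
          E j.1 j.2.1 j.2.2) {j | j.1 ∈ Z ∧ j.2.2.IsSymm}
    · obtain ⟨F, hF, hFs, -⟩ :=
        (CovariantPDE.isOpen_violating hηb hηd hc).exists_contDiff_support_eq (n := ⊤)
      exact ⟨F, fun _ => hFs, fun κ => by rw [← hF, Function.notMem_support]⟩
    -- Without continuity the indicator function of the violating set suffices.
    · classical
      exact ⟨fun κ => if κ ∈ CovariantPDE.violating η Z E then 1 else 0, fun h => absurd h hc,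
        fun κ => by simp⟩
  obtain ⟨F, hFs, hF0⟩ := hF
  have hback : ∀ z ∈ Z, ∀ w, ContDiffAt ℝ 2 w z → CovariantPDE.IsGeneric η w z →
      F (CovariantPDE.I1 η w z, CovariantPDE.I2 η w z) = 0 →
      CovariantPDE.covariant E w z = 0 := fun z hz w hw hgen h => by
    by_contra hne
    exact (hF0 _).mp h ⟨z, hz, w, hw, hgen, rfl, rfl, hne⟩
  refine ⟨F, hFs, fun V w hV hVZ hw hgen => ?_, fun hloc z hz w hw hwz hgen => ⟨fun h => ?_,
    hback z hz w (hw.of_le hr2) hgen⟩⟩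
  · have hwc : ∀ z ∈ V, ContDiffAt ℝ 2 w z := fun z hz =>
      (hw.contDiffAt (hV.mem_nhds hz)).of_le hr2
    have hjet : ∀ Ω u, CovariantPDE.IsFunctionIn r Z Ω u →
        CovariantPDE.graph Ω u ⊆ {z ∈ V | w z = 0} → ∀ x ∈ Ω,
        CovariantPDE.grad u x = CovariantPDE.implicitGrad w (CovariantPDE.pt x (u x)) ∧
        CovariantPDE.hess u x = CovariantPDE.implicitHess w (CovariantPDE.pt x (u x)) := by
      intro Ω u hu hg x hx
      have hxV := hg ⟨x, hx, rfl⟩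
      have huc : ContDiffAt ℝ 2 u x :=
        (hu.contDiffOn.contDiffAt (hu.isOpen.mem_nhds hx)).of_le hr2
      have h0 : ∀ᶠ y in nhds x, w (CovariantPDE.pt y (u y)) = 0 := by
        filter_upwards [hu.isOpen.mem_nhds hx] with y hy
        exact (hg ⟨y, hy, rfl⟩).2
      have hn := (hgen _ hxV.1 hxV.2).pd_last_ne
      exact ⟨CovariantPDE.grad_eq_implicitGrad (huc.differentiableAt (by norm_num))
        ((hwc _ hxV.1).differentiableAt (by norm_num)) h0 hn,
        CovariantPDE.hess_eq_implicitHess huc (hwc _ hxV.1) h0 hn⟩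
    have h1 : CovariantPDE.SurfaceIsSolution r Z E V w ↔
        ∀ z ∈ V, w z = 0 → CovariantPDE.covariant E w z = 0 := by
      refine ⟨fun h z hz hwz => ?_, fun h Ω u hu hg => ⟨hu, fun x hx => ?_⟩⟩
      · obtain ⟨Ω, u, hu, hg, x, hx, hxz⟩ :=
          CovariantPDE.exists_implicit hr hV hVZ hw hz hwz (hgen z hz hwz).pd_last_ne
        have := (h Ω u hu hg).eq_zero x hx
        rwa [(hjet Ω u hu hg x hx).1, (hjet Ω u hu hg x hx).2, hxz] at this
      · rw [(hjet Ω u hu hg x hx).1, (hjet Ω u hu hg x hx).2]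
        exact h _ (hg ⟨x, hx, rfl⟩).1 (hg ⟨x, hx, rfl⟩).2
    refine ⟨h1, fun h z hz hwz => ?_, fun h z hz hwz =>
      hback z (hVZ hz) w (hwc z hz) (hgen z hz hwz) (h z hz hwz)⟩
    -- The equation is assumed along the whole surface, so the implicit function through `z` is a
    -- solution and `key` applies to its jet at `z`.
    obtain ⟨Ω, u, hu, hg, x, hx, rfl⟩ :=
      CovariantPDE.exists_implicit hr hV hVZ hw hz hwz (hgen z hz hwz).pd_last_ne
    rw [hF0]
    exact key (h1.mpr h Ω u hu hg) hx (hwc _ hz) (hgen _ hz hwz) (hjet Ω u hu hg x hx).1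
      (hjet Ω u hu hg x hx).2
  · have hw2 := hw.of_le hr2
    -- Here the equation is known at a single point only; local solvability supplies a solution with
    -- this jet.
    obtain ⟨Ω, u, hu, x, hx, rfl, hg, hh⟩ := hloc z hz (CovariantPDE.implicitGrad w z)
      (CovariantPDE.implicitHess w z)
      (by rw [CovariantPDE.implicitHess_eq hw2]
          exact CovariantPDE.jetHess_isSymm _ _ (CovariantPDE.symm_snd hw2)) h
    rw [hF0]
    exact key hu hx hw2 hgen hg hh
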